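/- Let $G$ be a finite connected simple graph with vertices $v_1,\dots,v_n$, all of degree at least $2$, and edges $e_1,\dots,e_m$, each parameterized over $[0,1]$. Let $c_j>0$ and $\mu_j>0$ ($j=1,\dots,m$) be constants. Let $\Gamma(v_i)$ be the set of indices of the edges with an endpoint at $v_i$. Let $\Phi^+,\Phi^-$ be the $n\times m$ matrices with $\Phi^+_{ij}=1$ if $e_j(0)=v_i$, $\Phi^-_{ij}=1$ if $e_j(1)=v_i$, and zero entries otherwise; $\Phi^\pm_w$ arises from $\Phi^\pm$ by multiplying the $j$-th column by $\mu_jc_j$. On the Hilbert space $X_2=\prod_{j=1}^m L^2(0,1;\mu_j\,dx)$ of complex functions let $A=\mathrm{diag}\big(c_1\frac{d^2}{dx^2},\dots,c_m\frac{d^2}{dx^2}\big)$ with domain $$D(A)=\Big\{f\in \big(H^2(0,1)\big)^m:\ \Phi_w^+f'(0)=\Phi_w^-f'(1)\ \text{ and }\ \exists d\in\mathbb C^n:\ (\Phi^+)^\top d=f(0),\ (\Phi^-)^\top d=f(1)\Big\}.$$ Put $\mathrm{Sin}\,x=\mathrm{diag}(\sin\frac{x}{\sqrt{c_j}})_j$,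 $\mathrm{Cos}\,x=\mathrm{diag}(\cos\frac{x}{\sqrt{c_j}})_j$ and $C=\mathrm{diag}(1/\sqrt{c_j})_j$. For $\lambda>0$ with $\lambda\neq c_ik^2\pi^2$ for all $i$ and all $k\in\mathbb Z$, let $\mathcal L_C(\lambda)=D_C(\lambda)-\mathbb A_C(\lambda)$, where $D_C(\lambda)$ is the $n\times n$ diagonal matrix with entries $\sum_{j\in\Gamma(v_i)}\mu_j\sqrt{c_j}\cot\sqrt{\lambda/c_j}$, and $\mathbb A_C(\lambda)$ is the $n\times n$ matrix whose entry at $(i,k)$ is $\mu_j\sqrt{c_j}\,\big(\sin\sqrt{\lambda/c_j}\big)^{-1}$ if $e_j$ is the edge joining $v_i$ and $v_k$, and $0$ if $i=k$ or there is no such edge. For $i\in\{1,\dots,m\}$ and $k\in\mathbb Z\setminus\{0\}$ say that $(b,d)\in\mathbb C^m\times\mathbb C^n$ is $(i,k)$-admissible if $(b,d)\ne(0,0)$, if for every edge $e_j$, with $e_j(0)=v_s$ and $e_j(1)=v_r$, $$\begin{cases} d_r=(-1)^{\sqrt{c_i/c_j}\,k}\,d_s, & \text{if } \sqrt{c_i/c_j}\,k\in\mathbb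 Z,\\ b_j=\dfrac{d_r}{\sin(\sqrt{c_i/c_j}\,k\pi)}-\cot\!\big(\sqrt{c_i/c_j}\,k\pi\big)\,d_s, & \text{otherwise,}\end{cases}$$ and if $$\Phi_w^-\,C\,\mathrm{Sin}(\sqrt{c_i}k\pi)\,(\Phi^+)^\top d=\big(\Phi_w^-\,C\,\mathrm{Cos}(\sqrt{c_i}k\pi)-\Phi_w^+\,C\big)b .$$ Then $\sigma(A)=\{0\}\cup\sigma_C\cup\sigma_{\mathcal L}$, where $$\sigma_C=\{-c_ik^2\pi^2:\ 1\le i\le m,\ k\in\mathbb Z\setminus\{0\},\ \text{there is an $(i,k)$-admissible pair }(b,d)\},$$ $$\sigma_{\mathcal L}=\{-\lambda:\ \lambda>0,\ \lambda\ne c_ik^2\pi^2\text{ for all } i \text{ and all } k\in\mathbb Z,\ \det\mathcal L_C(\lambda)=0\}.$$ Furthermore: 1. $0$ is an eigenvalue of $A$ of geometric and algebraic multiplicity $1$, and the constant function $\mathbf 1$ is an eigenvector. 2. Let $\lambda>0$ with $\lambda\ne c_ik^2\pi^2$ for all $i$ and all $k\in\mathbb Z$. Then $-\lambda$ is an eigenvalue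 of $A$ if and only if $\det\mathcal L_C(\lambda)=0$. The eigenvectors for $-\lambda$ are exactly the functions $$f(x)=\mathrm{Cos}(\sqrt\lambda x)(\Phi^+)^\top d+(\mathrm{Sin}\sqrt\lambda)^{-1}\,\mathrm{Sin}(\sqrt\lambda x)\big((\Phi^-)^\top-\mathrm{Cos}(\sqrt\lambda)(\Phi^+)^\top\big)d,\qquad 0\ne d\in\ker\mathcal L_C(\lambda),$$ and the geometric and the algebraic multiplicity of $-\lambda$ are both equal to $\dim\ker\mathcal L_C(\lambda)$ (multiplicity $0$ meaning that $-\lambda$ is not an eigenvalue). 3. Let $1\le i\le m$ and $k\in\mathbb Z\setminus\{0\}$. Then $-c_ik^2\pi^2$ is an eigenvalue of $A$ if and only if there is an $(i,k)$-admissible pair $(b,d)$. The eigenvectors for $-c_ik^2\pi^2$ are exactly the functions $$f(x)=\mathrm{Cos}(\sqrt{c_i}k\pi x)(\Phi^+)^\top d+\mathrm{Sin}(\sqrt{c_i}k\pi x)\,b$$ with $(i,k)$-admissible $(b,d)$. -/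

import Mathlib

open MeasureTheory Set
open scoped ContDiff ENNReal Matrix

/-- A finite connected network: a simple connected graph on the vertices `Fin n`, all of whose
vertices have degree at least two, whose edges are numbered by `Fin m` and parameterized over
`[0,1]` (the `j`-th edge runs from `src j`, at `x = 0`, to `tgt j`, at `x = 1`), together with
strictly positive constants `c j` (the weights) and `μ j` on the edges. -/
structure Network (n m : ℕ) where
  graph : SimpleGraph (Fin n)
  connected : graph.Connected
  two_le_degree : ∀ v, 2 ≤ (graph.neighborSet v).ncard
  src : Fin m → Fin n
  tgt : Fin m → Fin n
  edge_mem : ∀ j, s(src j, tgt j) ∈ graph.edgeSet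
  edge_bij : ∀ e ∈ graph.edgeSet, ∃! j, s(src j, tgt j) = e
  c : Fin m → ℝ
  c_pos : ∀ j, 0 < c j
  μ : Fin m → ℝ
  μ_pos : ∀ j, 0 < μ j

/-- `g` is the weak (distributional) derivative of `f` on the interval `(0,1)`. -/
def IsWeakDeriv (f g : ℝ → ℂ) : Prop :=
  ∀ φ : ℝ → ℝ, ContDiff ℝ ∞ φ → HasCompactSupport φ → tsupport φ ⊆ Ioo 0 1 →
    ∫ x in Ioo (0 : ℝ) 1, deriv φ x • f x = - ∫ x in Ioo (0 : ℝ) 1, φ x • g x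

/-- `u` is a representative of the class of `f` that is continuous on `[0,1]`; its values at `0`
and `1` are the boundary values of `f`. -/
def IsContRep (u f : ℝ → ℂ) : Prop :=
  ContinuousOn u (Icc 0 1) ∧ ∀ᵐ x ∂(volume.restrict (Ioo (0 : ℝ) 1)), f x = u x

lemma IsWeakDeriv.add {f g f' g' : ℝ → ℂ}
    (hf : IntegrableOn f (Ioo 0 1)) (hg : IntegrableOn g (Ioo 0 1))
    (hf' : IntegrableOn f' (Ioo 0 1)) (hg' : IntegrableOn g' (Ioo 0 1))
    (h : IsWeakDeriv f g) (h' : IsWeakDeriv f' g') : IsWeakDeriv (f + f') (g + g') := by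
  intro φ h1 h2 h3
  have key : ∀ ψ : ℝ → ℝ, Continuous ψ → HasCompactSupport ψ → ∀ w : ℝ → ℂ,
      IntegrableOn w (Ioo 0 1) → Integrable (fun x => ψ x • w x) (volume.restrict (Ioo 0 1)) := by
    intro ψ c1 c2 w hw
    obtain ⟨C, hC⟩ := c2.exists_bound_of_continuous c1
    exact hw.bdd_smul C c1.aestronglyMeasurable (Filter.Eventually.of_forall hC)
  have d1 : Continuous (deriv φ) := h1.continuous_deriv (by simp)
  have d2 : HasCompactSupport (deriv φ) := h2.deriv
  simp only [Pi.add_apply, smul_add]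
  rw [integral_add (key _ d1 d2 _ hf) (key _ d1 d2 _ hf'),
    integral_add (key _ h1.continuous h2 _ hg) (key _ h1.continuous h2 _ hg'),
    h φ h1 h2 h3, h' φ h1 h2 h3, neg_add]

lemma IsWeakDeriv.smul {f g : ℝ → ℂ} (a : ℂ) (h : IsWeakDeriv f g) :
    IsWeakDeriv (a • f) (a • g) := by
  intro φ h1 h2 h3
  simp only [Pi.smul_apply, smul_comm _ a]
  rw [integral_smul, integral_smul, h φ h1 h2 h3, smul_neg]

lemma IsWeakDeriv.congr {f g f' g' : ℝ → ℂ} (h : IsWeakDeriv f g)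
    (hf : f' =ᵐ[volume.restrict (Ioo 0 1)] f) (hg : g' =ᵐ[volume.restrict (Ioo 0 1)] g) :
    IsWeakDeriv f' g' := by
  intro φ h1 h2 h3
  have e1 : ∫ x in Ioo (0 : ℝ) 1, deriv φ x • f' x = ∫ x in Ioo (0 : ℝ) 1, deriv φ x • f x :=
    integral_congr_ae (hf.mono fun x hx => by simp only [hx])
  have e2 : ∫ x in Ioo (0 : ℝ) 1, φ x • g' x = ∫ x in Ioo (0 : ℝ) 1, φ x • g x :=
    integral_congr_ae (hg.mono fun x hx => by simp only [hx])
  rw [e1, e2, h φ h1 h2 h3]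

lemma IsWeakDeriv.unique {f g g' : ℝ → ℂ}
    (hg : IntegrableOn g (Ioo 0 1)) (hg' : IntegrableOn g' (Ioo 0 1))
    (h : IsWeakDeriv f g) (h' : IsWeakDeriv f g') : g =ᵐ[volume.restrict (Ioo 0 1)] g' := by
  have hs : IntegrableOn (g - g') (Ioo 0 1) := hg.sub hg'
  have := isOpen_Ioo.ae_eq_zero_of_integral_contDiff_smul_eq_zero
    (μ := volume.restrict (Ioo (0 : ℝ) 1)) (U := Ioo (0 : ℝ) 1) (f := g - g')
    (hs.locallyIntegrable.locallyIntegrableOn _) (by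
      intro φ h1 h2 h3
      obtain ⟨C, hC⟩ := h2.exists_bound_of_continuous h1.continuous
      have i1 : Integrable (fun x => φ x • g x) (volume.restrict (Ioo 0 1)) :=
        Integrable.bdd_smul hg C h1.continuous.aestronglyMeasurable
          (Filter.Eventually.of_forall hC)
      have i2 : Integrable (fun x => φ x • g' x) (volume.restrict (Ioo 0 1)) :=
        Integrable.bdd_smul hg' C h1.continuous.aestronglyMeasurable
          (Filter.Eventually.of_forall hC)
      simp only [Pi.sub_apply, smul_sub]
      rw [integral_sub i1 i2, sub_eq_zero]
      exact neg_injective ((h φ h1 h2 h3).symm.trans (h' φ h1 h2 h3)))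
  filter_upwards [this, ae_restrict_mem measurableSet_Ioo] with x hx hm
  exact sub_eq_zero.1 (hx hm)

lemma IsContRep.add {u v f g : ℝ → ℂ} (h : IsContRep u f) (h' : IsContRep v g) :
    IsContRep (u + v) (f + g) :=
  ⟨h.1.add h'.1, by filter_upwards [h.2, h'.2] with x hx hy; simp [hx, hy]⟩

lemma IsContRep.smul {u f : ℝ → ℂ} (a : ℂ) (h : IsContRep u f) : IsContRep (a • u) (a • f) :=
  ⟨h.1.const_smul a, by filter_upwards [h.2] with x hx; simp [hx]⟩

lemma IsContRep.congr {u f g : ℝ → ℂ} (h : IsContRep u f)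
    (hg : g =ᵐ[volume.restrict (Ioo 0 1)] f) : IsContRep u g :=
  ⟨h.1, by filter_upwards [h.2, hg] with x hx hy; rw [hy, hx]⟩

namespace Network

variable {n m : ℕ} (N : Network n m)

/-- The set `Γ(v)` of the indices of the edges that have an endpoint at `v`. -/
def Γ (v : Fin n) : Finset (Fin m) := Finset.univ.filter fun j => N.src j = v ∨ N.tgt j = v

/-- The incidence matrix of the initial points of the edges. -/
def Φp : Matrix (Fin n) (Fin m) ℂ := Matrix.of fun i j => if N.src j = i then 1 else 0

/-- The incidence matrix of the end points of the edges. -/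
def Φm : Matrix (Fin n) (Fin m) ℂ := Matrix.of fun i j => if N.tgt j = i then 1 else 0

/-- The weighted incidence matrix of the initial points of the edges. -/
def Φwp : Matrix (Fin n) (Fin m) ℂ :=
  Matrix.of fun i j => if N.src j = i then ((N.μ j * N.c j : ℝ) : ℂ) else 0

/-- The weighted incidence matrix of the end points of the edges. -/
def Φwm : Matrix (Fin n) (Fin m) ℂ :=
  Matrix.of fun i j => if N.tgt j = i then ((N.μ j * N.c j : ℝ) : ℂ) else 0

/-- The measure `μ_j dx` on the interval `(0,1)`. -/
noncomputable def edgeMeasure (j : Fin m) : Measure ℝ :=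
  ENNReal.ofReal (N.μ j) • volume.restrict (Ioo 0 1)

/-- The complex Hilbert space `∏_j L²(0,1; μ_j dx)`. -/
abbrev X : Type := PiLp 2 fun j : Fin m => Lp ℂ 2 (N.edgeMeasure j)

lemma ofReal_μ_ne_zero (j : Fin m) : ENNReal.ofReal (N.μ j) ≠ 0 := by
  simpa using N.μ_pos j

lemma ae_edge_iff {j : Fin m} {p : ℝ → Prop} :
    (∀ᵐ x ∂(N.edgeMeasure j), p x) ↔ ∀ᵐ x ∂(volume.restrict (Ioo (0 : ℝ) 1)), p x :=
  Measure.ae_ennreal_smul_measure_iff (N.ofReal_μ_ne_zero j)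

lemma integrableOn {j : Fin m} (f : Lp ℂ 2 (N.edgeMeasure j)) :
    IntegrableOn (f : ℝ → ℂ) (Ioo 0 1) := by
  have : IsFiniteMeasure (N.edgeMeasure j) := by
    constructor
    simp [edgeMeasure]
  have h := (Lp.memLp f).integrable (by norm_num)
  exact (integrable_smul_measure (N.ofReal_μ_ne_zero j) ENNReal.ofReal_ne_top).1 h

/-- `p` and `q` are the (componentwise weak) first and second derivatives of `f`; such `p`, `q` in
`X` exist if and only if every component of `f` lies in `H²(0,1)`. -/
def IsDerivs (f p q : N.X) : Prop :=
  ∀ j, IsWeakDeriv (f j) (p j) ∧ IsWeakDeriv (p j) (q j)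

/-- The vertex conditions on `f`, with weak derivative `p`: the Kirchhoff law
`Φ_w⁺ f'(0) = Φ_w⁻ f'(1)` and the continuity condition
`∃ d, (Φ⁺)ᵀ d = f(0) ∧ (Φ⁻)ᵀ d = f(1)`. -/
def VertexConditions (f p : N.X) : Prop :=
  ∃ u v : Fin m → ℝ → ℂ,
    (∀ j, IsContRep (u j) (f j)) ∧ (∀ j, IsContRep (v j) (p j)) ∧
    (N.Φwp *ᵥ fun j => v j 0) = (N.Φwm *ᵥ fun j => v j 1) ∧
    ∃ d : Fin n → ℂ, (N.Φpᵀ *ᵥ d) = (fun j => u j 0) ∧ (N.Φmᵀ *ᵥ d) = fun j => u j 1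

lemma IsDerivs.add {f p q f' p' q' : N.X} (h : N.IsDerivs f p q) (h' : N.IsDerivs f' p' q') :
    N.IsDerivs (f + f') (p + p') (q + q') := by
  have key : ∀ (a b : N.X) (j : Fin m), ((a + b) j : ℝ → ℂ) =ᵐ[volume.restrict (Ioo 0 1)]
      ((a j : ℝ → ℂ) + (b j : ℝ → ℂ)) := fun a b j => N.ae_edge_iff.1 (Lp.coeFn_add (a j) (b j))
  intro j
  exact ⟨((h j).1.add (N.integrableOn _) (N.integrableOn _) (N.integrableOn _)
      (N.integrableOn _) (h' j).1).congr (key _ _ j) (key _ _ j),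
    ((h j).2.add (N.integrableOn _) (N.integrableOn _) (N.integrableOn _)
      (N.integrableOn _) (h' j).2).congr (key _ _ j) (key _ _ j)⟩

lemma IsDerivs.smul {f p q : N.X} (a : ℂ) (h : N.IsDerivs f p q) :
    N.IsDerivs (a • f) (a • p) (a • q) := by
  have key : ∀ (b : N.X) (j : Fin m), ((a • b) j : ℝ → ℂ) =ᵐ[volume.restrict (Ioo 0 1)]
      (a • (b j : ℝ → ℂ)) := fun b j => N.ae_edge_iff.1 (Lp.coeFn_smul a (b j))
  intro j
  exact ⟨((h j).1.smul a).congr (key _ j) (key _ j), ((h j).2.smul a).congr (key _ j) (key _ j)⟩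

lemma IsDerivs.unique {f p q p' q' : N.X} (h : N.IsDerivs f p q) (h' : N.IsDerivs f p' q') :
    p = p' ∧ q = q' := by
  have hp : p = p' := by
    ext1 j
    exact Lp.ext (N.ae_edge_iff.2
      ((h j).1.unique (N.integrableOn _) (N.integrableOn _) (h' j).1))
  subst hp
  refine ⟨rfl, ?_⟩
  ext1 j
  exact Lp.ext (N.ae_edge_iff.2
    ((h j).2.unique (N.integrableOn _) (N.integrableOn _) (h' j).2))

lemma isDerivs_zero : N.IsDerivs 0 0 0 := by
  have key : ∀ j : Fin m, ((0 : N.X) j : ℝ → ℂ) =ᵐ[volume.restrict (Ioo 0 1)]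
      (0 : ℝ → ℂ) := fun j => N.ae_edge_iff.1 (Lp.coeFn_zero _ _ _)
  have h0 : IsWeakDeriv 0 0 := fun φ _ _ _ => by simp
  exact fun j => ⟨h0.congr (key j) (key j), h0.congr (key j) (key j)⟩

lemma VertexConditions.add {f p f' p' : N.X} (h : N.VertexConditions f p)
    (h' : N.VertexConditions f' p') : N.VertexConditions (f + f') (p + p') := by
  have key : ∀ (a b : N.X) (j : Fin m), ((a + b) j : ℝ → ℂ) =ᵐ[volume.restrict (Ioo 0 1)]
      ((a j : ℝ → ℂ) + (b j : ℝ → ℂ)) := fun a b j => N.ae_edge_iff.1 (Lp.coeFn_add (a j) (b j))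
  obtain ⟨u, v, hu, hv, hk, d, d0, d1⟩ := h
  obtain ⟨u', v', hu', hv', hk', d', d0', d1'⟩ := h'
  refine ⟨u + u', v + v', fun j => ((hu j).add (hu' j)).congr (key _ _ j),
    fun j => ((hv j).add (hv' j)).congr (key _ _ j), ?_, d + d', ?_, ?_⟩
  · have e := congrArg₂ (· + ·) hk hk'
    simp only [← Matrix.mulVec_add] at e
    exact e
  · rw [Matrix.mulVec_add, d0, d0']; rfl
  · rw [Matrix.mulVec_add, d1, d1']; rfl

lemma VertexConditions.smul {f p : N.X} (a : ℂ) (h : N.VertexConditions f p) :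
    N.VertexConditions (a • f) (a • p) := by
  have key : ∀ (b : N.X) (j : Fin m), ((a • b) j : ℝ → ℂ) =ᵐ[volume.restrict (Ioo 0 1)]
      (a • (b j : ℝ → ℂ)) := fun b j => N.ae_edge_iff.1 (Lp.coeFn_smul a (b j))
  obtain ⟨u, v, hu, hv, hk, d, d0, d1⟩ := h
  refine ⟨a • u, a • v, fun j => ((hu j).smul a).congr (key _ j),
    fun j => ((hv j).smul a).congr (key _ j), ?_, a • d, ?_, ?_⟩
  · have e := congrArg (a • ·) hk
    simp only [← Matrix.mulVec_smul] at e
    exact e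
  · rw [Matrix.mulVec_smul, d0]; rfl
  · rw [Matrix.mulVec_smul, d1]; rfl

lemma vertexConditions_zero : N.VertexConditions 0 0 := by
  have key : ∀ j : Fin m, IsContRep 0 ((0 : N.X) j : ℝ → ℂ) :=
    fun j => ⟨continuousOn_const, N.ae_edge_iff.1 (Lp.coeFn_zero _ _ _)⟩
  refine ⟨0, 0, key, key, ?_, 0, ?_, ?_⟩
  · exact (Matrix.mulVec_zero N.Φwp).trans (Matrix.mulVec_zero N.Φwm).symm
  · simp; rfl
  · simp; rfl

/-- The domain `D(A)`: all `f` in `∏_j H²(0,1)` that satisfy the vertex conditions. -/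
def domain : Submodule ℂ N.X where
  carrier := {f | ∃ p q : N.X, N.IsDerivs f p q ∧ N.VertexConditions f p}
  add_mem' := by
    rintro f f' ⟨p, q, h1, h2⟩ ⟨p', q', h1', h2'⟩
    exact ⟨p + p', q + q', h1.add N h1', h2.add N h2'⟩
  zero_mem' := ⟨0, 0, N.isDerivs_zero, N.vertexConditions_zero⟩
  smul_mem' := by
    rintro a f ⟨p, q, h1, h2⟩
    exact ⟨a • p, a • q, h1.smul N a, h2.smul N a⟩

/-- The second derivative of a function in `D(A)`. -/
noncomputable def secondDeriv (f : N.domain) : N.X := f.2.choose_spec.choose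

lemma secondDeriv_spec (f : N.domain) : ∃ p, N.IsDerivs f p (N.secondDeriv f) :=
  ⟨f.2.choose, f.2.choose_spec.choose_spec.1⟩

lemma secondDeriv_eq {f : N.domain} {p q : N.X} (h : N.IsDerivs f p q) : N.secondDeriv f = q :=
  ((N.secondDeriv_spec f).choose_spec.unique N h).2

/-- The operator `A = diag(c_j d²/dx²)` with domain `D(A)`. -/
noncomputable def A : N.X →ₗ.[ℂ] N.X where
  domain := N.domain
  toFun :=
    { toFun := fun f => WithLp.toLp 2 fun j => (N.c j : ℂ) • N.secondDeriv f j
      map_add' := by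
        intro f g
        obtain ⟨p, hp⟩ := N.secondDeriv_spec f
        obtain ⟨p', hp'⟩ := N.secondDeriv_spec g
        rw [N.secondDeriv_eq (f := f + g) (hp.add N hp')]
        ext1 j
        simp
      map_smul' := by
        intro a f
        obtain ⟨p, hp⟩ := N.secondDeriv_spec f
        rw [N.secondDeriv_eq (f := a • f) (hp.smul N a)]
        ext1 j
        exact smul_comm (N.c j : ℂ) a (N.secondDeriv f j) }

/-- The generalized weighted adjacency matrix `A_C(l)`: its entry at `(i, k)` is
`μ_j √c_j / sin √(l/c_j)` if `j` is the edge between `v_i` and `v_k`, and `0` if there is none.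
`Γ(v_i) ∩ Γ(v_k)` has at most one element for `i ≠ k`, since the graph is simple, so the sum
below has at most one term; the diagonal entries vanish because there are no loops. -/
noncomputable def adjC (l : ℝ) : Matrix (Fin n) (Fin n) ℂ :=
  Matrix.of fun i k => if i = k then 0 else
    ∑ j ∈ N.Γ i ∩ N.Γ k,
      ((N.μ j * Real.sqrt (N.c j) * (Real.sin (Real.sqrt (l / N.c j)))⁻¹ : ℝ) : ℂ)

/-- The generalized weighted degree matrix `D_C(l)`, with the diagonal entries
`∑_{j ∈ Γ(v_i)} μ_j √c_j cot √(l/c_j)`. -/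
noncomputable def degC (l : ℝ) : Matrix (Fin n) (Fin n) ℂ :=
  Matrix.diagonal fun i => ∑ j ∈ N.Γ i,
    ((N.μ j * Real.sqrt (N.c j) * Real.cot (Real.sqrt (l / N.c j)) : ℝ) : ℂ)

/-- The generalized weighted Laplacian matrix `L_C(l) = D_C(l) - A_C(l)`. -/
noncomputable def lapC (l : ℝ) : Matrix (Fin n) (Fin n) ℂ := N.degC l - N.adjC l

/-- The matrix `diag(sin(x/√c_1), …, sin(x/√c_m))`. -/
noncomputable def Sin (x : ℝ) : Matrix (Fin m) (Fin m) ℂ :=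
  Matrix.diagonal fun j => ((Real.sin (x / Real.sqrt (N.c j)) : ℝ) : ℂ)

/-- The matrix `diag(cos(x/√c_1), …, cos(x/√c_m))`. -/
noncomputable def Cos (x : ℝ) : Matrix (Fin m) (Fin m) ℂ :=
  Matrix.diagonal fun j => ((Real.cos (x / Real.sqrt (N.c j)) : ℝ) : ℂ)

/-- The matrix `diag(1/√c_1, …, 1/√c_m)`. -/
noncomputable def C : Matrix (Fin m) (Fin m) ℂ :=
  Matrix.diagonal fun j => ((1 / Real.sqrt (N.c j) : ℝ) : ℂ)

/-- `f` is the class of the function `F : [0,1] → ℂᵐ`. -/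
def Represents (f : N.X) (F : ℝ → Fin m → ℂ) : Prop :=
  ∀ j, ∀ᵐ x ∂(N.edgeMeasure j), f j x = F x j

/-- `l > 0` is none of the numbers `c_i k² π²` with `k ∈ ℤ`. -/
def NonResonant (l : ℝ) : Prop :=
  0 < l ∧ ∀ (i : Fin m) (k : ℤ), l ≠ N.c i * (k : ℝ) ^ 2 * Real.pi ^ 2

/-- The function
`Cos(√l x) (Φ⁺)ᵀ d + Sin(√l)⁻¹ Sin(√l x) ((Φ⁻)ᵀ - Cos(√l) (Φ⁺)ᵀ) d`. -/
noncomputable def nonresFun (l : ℝ) (d : Fin n → ℂ) (x : ℝ) : Fin m → ℂ :=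
  (N.Cos (Real.sqrt l * x) * N.Φpᵀ) *ᵥ d +
    ((N.Sin (Real.sqrt l))⁻¹ * N.Sin (Real.sqrt l * x) *
      (N.Φmᵀ - N.Cos (Real.sqrt l) * N.Φpᵀ)) *ᵥ d

/-- The function `Cos(√c_i k π x) (Φ⁺)ᵀ d + Sin(√c_i k π x) b`. -/
noncomputable def resFun (i : Fin m) (k : ℤ) (b : Fin m → ℂ) (d : Fin n → ℂ) (x : ℝ) :
    Fin m → ℂ :=
  (N.Cos (Real.sqrt (N.c i) * k * Real.pi * x) * N.Φpᵀ) *ᵥ d +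
    N.Sin (Real.sqrt (N.c i) * k * Real.pi * x) *ᵥ b

/-- The linear conditions on `b` and `d` at the point `-c_i k² π²`. On each edge, from `v_s` to
`v_r`, one has `d_r = (-1)^K d_s` if `K = √(c_i/c_j) k` is an integer, and
`b_j = sin(√(c_i/c_j) k π)⁻¹ d_r - cot(√(c_i/c_j) k π) d_s` otherwise; moreover
`Φ_w⁻ C Sin(√c_i k π) (Φ⁺)ᵀ d = (Φ_w⁻ C Cos(√c_i k π) - Φ_w⁺ C) b`. -/
def ResConditions (i : Fin m) (k : ℤ) (b : Fin m → ℂ) (d : Fin n → ℂ) : Prop :=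
  (∀ j : Fin m,
    (∀ K : ℤ, Real.sqrt (N.c i / N.c j) * k = K →
      d (N.tgt j) = (-1 : ℂ) ^ K * d (N.src j)) ∧
    ((¬ ∃ K : ℤ, Real.sqrt (N.c i / N.c j) * k = K) →
      b j = (((Real.sin (Real.sqrt (N.c i / N.c j) * k * Real.pi))⁻¹ : ℝ) : ℂ) * d (N.tgt j) -
        ((Real.cot (Real.sqrt (N.c i / N.c j) * k * Real.pi) : ℝ) : ℂ) * d (N.src j))) ∧
  (N.Φwm * N.C * N.Sin (Real.sqrt (N.c i) * k * Real.pi) * N.Φpᵀ) *ᵥ d =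
    (N.Φwm * N.C * N.Cos (Real.sqrt (N.c i) * k * Real.pi) - N.Φwp * N.C) *ᵥ b

/-- The points `-c_i k² π²`, `k ∈ ℤ ∖ {0}`, at which the linear conditions have a nontrivial
solution. -/
def σC : Set ℂ :=
  {z | ∃ (i : Fin m) (k : ℤ), k ≠ 0 ∧
    z = ((-(N.c i * (k : ℝ) ^ 2 * Real.pi ^ 2) : ℝ) : ℂ) ∧
    ∃ b d, (b ≠ 0 ∨ d ≠ 0) ∧ N.ResConditions i k b d}

/-- The points `-l` with `l > 0`, `l ≠ c_i k² π²` and `det L_C(l) = 0`. -/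
def σL : Set ℂ :=
  {z | ∃ l : ℝ, z = ((-l : ℝ) : ℂ) ∧ N.NonResonant l ∧ (N.lapC l).det = 0}

end Network

section Operators

variable {E : Type*} [NormedAddCommGroup E] [NormedSpace ℂ E] (T : E →ₗ.[ℂ] E)

/-- The spectrum of a linear operator `T : D(T) → E`: the set of all `z` for which
`z - T : D(T) → E` has no bounded everywhere defined inverse. -/
def opSpectrum : Set ℂ :=
  {z | ¬ ∃ R : E →L[ℂ] E,
    (∀ g : E, ∃ h : R g ∈ T.domain, z • R g - T ⟨R g, h⟩ = g) ∧
    ∀ f : T.domain, R (z • (f : E) - T f) = f}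

/-- `f` is an eigenvector of `T` for the eigenvalue `z`. -/
def IsEigenvec (z : ℂ) (f : E) : Prop := f ≠ 0 ∧ ∃ h : f ∈ T.domain, T ⟨f, h⟩ = z • f

/-- `z` is an eigenvalue of `T`. -/
def IsEigenval (z : ℂ) : Prop := ∃ f, IsEigenvec T z f

/-- `ker (T - z)^k`, where `f` lies in the domain of `(T - z)^(k+1)` if and only if `f ∈ D(T)` and
`T f - z f` lies in the domain of `(T - z)^k`. -/
def kerPow (z : ℂ) : ℕ → Submodule ℂ E
  | 0 => ⊥
  | k + 1 => ((kerPow z k).comap (T.toFun - z • T.domain.subtype)).map T.domain.subtype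

/-- The geometric multiplicity `dim ker (T - z)`. -/
noncomputable def geomMult (z : ℂ) : Cardinal := Module.rank ℂ (kerPow T z 1)

/-- The algebraic multiplicity: the dimension of the space of all generalized eigenvectors, the
union of the `ker (T - z)^k`. -/
noncomputable def algMult (z : ℂ) : Cardinal := Module.rank ℂ (⨆ k, kerPow T z k : Submodule ℂ E)

end Operators

/-!
On every edge the eigenvalue equation `c_j f_j'' = -W² f_j` with `W ≠ 0` has the solutions
`cos (w_j x) a_j + sin (w_j x) b_j` with `w_j = W / √c_j`. Continuity at the initial points says
`a_j = d (src j)` for a vector `d` of vertex values, so an eigenfunction is a pair `(b, d)` in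
`ℂᵐ × ℂⁿ`, subject to the `m` continuity conditions at the end points of the edges and the `n`
Kirchhoff conditions (`Network.A_eq_smul_iff`). If `sin w_j ≠ 0` for all `j`, the continuity
conditions determine `b` by `d`, and the Kirchhoff conditions become `lapC l *ᵥ d = 0`
(`Network.vertexMap_eq_zero_iff_lapC`). At a resonance the same conditions are those of
`ResConditions` (`Network.resConditions_iff`).

Green's formula `⟪f, A g⟫ = -∑ μ_j c_j ∫ conj f_j' g_j'` (`Network.Solves.inner_eq`) shows that `A`
is symmetric and negative. So the eigenvalues are real and nonpositive, the kernel consists of the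
functions that are constant on each edge, hence constant as the graph is connected, and there are no
proper generalized eigenvectors (`iSup_kerPow_of_symmetric`).

The spectrum consists of eigenvalues, because the linear system for `(b, d)` is square: if `-W²` is
not an eigenvalue, the system is solvable for every right-hand side, and a particular solution of
the inhomogeneous equation, obtained on each edge by variation of constants, can be corrected so as
to satisfy the vertex conditions (`Network.exists_sub_A_eq`). The inverse is bounded by the closed
graph theorem and the symmetry of `A` (`notMem_opSpectrum_of_symmetric`).

The link between the weak derivatives in the definition of `A` and pointwise calculus is the notion
of an absolutely continuous function with a given integrable derivative, `IsPrimitive`: the product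
rule for such functions is Fubini's theorem, and the lemma of du Bois-Reymond shows that functions
with an integrable weak derivative are of this kind (`IsWeakDeriv.exists_isPrimitive`).
-/

/-! ### Absolutely continuous functions on the unit interval -/

/-- `u` is absolutely continuous on `[0,1]` with the integrable derivative `g`, written as
`u x = u 0 + ∫ t in 0..x, g t`. Only the values of `u` on `[0,1]` matter. -/
def IsPrimitive (u g : ℝ → ℂ) : Prop :=
  IntegrableOn g (Ioo 0 1) ∧ ∀ x ∈ Icc (0 : ℝ) 1, u x = u 0 + ∫ t in (0 : ℝ)..x, g t

/-- Integration by parts for two primitives that vanish at `0`: the two iterated integrals are the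
integrals of `g ⊗ h` over the two triangles of a square. -/
lemma setIntegral_mul_primitive_add {g h : ℝ → ℂ} {y : ℝ} (hg : IntegrableOn g (Ioc 0 y))
    (hh : IntegrableOn h (Ioc 0 y)) :
    (∫ x in Ioc 0 y, (g x * ∫ t in Ioc 0 x, h t)) +
        ∫ t in Ioc 0 y, ((∫ x in Ioc 0 t, g x) * h t) =
      (∫ x in Ioc 0 y, g x) * ∫ x in Ioc 0 y, h x := by
  set ν : Measure ℝ := volume.restrict (Ioc 0 y) with hν
  have hi : Integrable (fun p : ℝ × ℝ => g p.1 * h p.2) (ν.prod ν) := Integrable.mul_prod hg hh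
  -- the triangle below the diagonal; its complement gives the second iterated integral
  let S : Set (ℝ × ℝ) := {p | p.2 ≤ p.1}
  have hS : MeasurableSet S := measurableSet_le measurable_snd measurable_fst
  have e1 : ∫ x in Ioc 0 y, (g x * ∫ t in Ioc 0 x, h t) =
      ∫ p in S, g p.1 * h p.2 ∂(ν.prod ν) := by
    rw [← integral_indicator hS, integral_prod _ (hi.indicator hS)]
    refine setIntegral_congr_fun measurableSet_Ioc fun x hx => ?_
    have : (fun t => S.indicator (fun p : ℝ × ℝ => g p.1 * h p.2) (x, t)) =
        fun t => g x * (Iic x).indicator h t := by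
      funext t
      by_cases ht : t ≤ x <;> simp [S, indicator, ht]
    simp only [this]
    rw [integral_const_mul, integral_indicator measurableSet_Iic, hν,
      Measure.restrict_restrict measurableSet_Iic]
    congr 3
    ext t
    simp only [mem_Ioc, mem_inter_iff, mem_Iic] at hx ⊢
    grind
  have e2 : ∫ t in Ioc 0 y, ((∫ x in Ioc 0 t, g x) * h t) =
      ∫ p in Sᶜ, g p.1 * h p.2 ∂(ν.prod ν) := by
    rw [← integral_indicator hS.compl, integral_prod_symm _ (hi.indicator hS.compl)]
    refine setIntegral_congr_fun measurableSet_Ioc fun t ht => ?_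
    have : (fun x => Sᶜ.indicator (fun p : ℝ × ℝ => g p.1 * h p.2) (x, t)) =
        fun x => (Iio t).indicator g x * h t := by
      funext x
      by_cases hx : x < t <;> simp [S, indicator, hx]
    simp only [this]
    rw [integral_mul_const, integral_indicator measurableSet_Iio, hν,
      Measure.restrict_restrict measurableSet_Iio, integral_Ioc_eq_integral_Ioo]
    congr 3
    ext x
    simp only [mem_Ioc, mem_Ioo, mem_inter_iff, mem_Iio] at ht ⊢
    grind
  rw [e1, e2, integral_add_compl hS hi, integral_prod_mul]

namespace IsPrimitive

variable {u v g h h' : ℝ → ℂ}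

lemma intervalIntegrable (hu : IsPrimitive u g) : IntervalIntegrable g volume 0 1 :=
  (intervalIntegrable_iff_integrableOn_Ioo_of_le zero_le_one).2 hu.1

lemma continuousOn (hu : IsPrimitive u g) : ContinuousOn u (Icc 0 1) := by
  have h := intervalIntegral.continuousOn_primitive_interval' hu.intervalIntegrable
    (left_mem_uIcc)
  rw [uIcc_of_le zero_le_one] at h
  exact (continuousOn_const.add h).congr hu.2

lemma congr_deriv (hu : IsPrimitive u g) (h : g =ᵐ[volume.restrict (Ioo 0 1)] h') :
    IsPrimitive u h' := by
  refine ⟨hu.1.congr h, fun x hx => (hu.2 x hx).trans ?_⟩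
  congr 1
  rw [intervalIntegral.integral_of_le hx.1, intervalIntegral.integral_of_le hx.1,
    integral_Ioc_eq_integral_Ioo, integral_Ioc_eq_integral_Ioo]
  exact integral_congr_ae (ae_restrict_of_ae_restrict_of_subset (Ioo_subset_Ioo_right hx.2) h)

lemma congr_deriv_on (hu : IsPrimitive u g) (h : ∀ x ∈ Ioo (0 : ℝ) 1, g x = h' x) :
    IsPrimitive u h' :=
  hu.congr_deriv ((ae_restrict_iff' measurableSet_Ioo).2 (Filter.Eventually.of_forall h))

lemma congr_fun (hu : IsPrimitive u g) (h : ∀ x ∈ Icc (0 : ℝ) 1, v x = u x) :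
    IsPrimitive v g :=
  ⟨hu.1, fun x hx => by rw [h x hx, h 0 (by simp), hu.2 x hx]⟩

lemma add (hu : IsPrimitive u g) (hv : IsPrimitive v h) :
    IsPrimitive (fun x => u x + v x) (fun x => g x + h x) := by
  refine ⟨hu.1.add hv.1, fun x hx => ?_⟩
  have hs : uIcc (0 : ℝ) x ⊆ uIcc 0 1 := by
    rw [uIcc_of_le hx.1, uIcc_of_le zero_le_one]; exact Icc_subset_Icc_right hx.2
  simp only
  rw [intervalIntegral.integral_add (hu.intervalIntegrable.mono_set hs)
    (hv.intervalIntegrable.mono_set hs), hu.2 x hx, hv.2 x hx]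
  ring

lemma const_mul (a : ℂ) (hu : IsPrimitive u g) :
    IsPrimitive (fun x => a * u x) (fun x => a * g x) := by
  refine ⟨hu.1.const_mul a, fun x hx => ?_⟩
  simp only
  rw [intervalIntegral.integral_const_mul, hu.2 x hx, mul_add]

lemma conj (hu : IsPrimitive u g) :
    IsPrimitive (fun x => (starRingEnd ℂ) (u x)) (fun x => (starRingEnd ℂ) (g x)) := by
  refine ⟨?_, fun x hx => ?_⟩
  · exact (Complex.conjCLE.toContinuousLinearMap.integrable_comp hu.1)
  · simp only
    rw [hu.2 x hx, map_add, intervalIntegral.integral_of_le hx.1,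
      intervalIntegral.integral_of_le hx.1, integral_conj]

/-- A continuously differentiable function is a primitive of its derivative. -/
lemma of_hasDerivAt (h : ∀ x, HasDerivAt u (g x) x) (hg : Continuous g) : IsPrimitive u g := by
  refine ⟨(hg.integrableOn_Icc (a := 0) (b := 1)).mono_set Ioo_subset_Icc_self, fun x _ => ?_⟩
  rw [intervalIntegral.integral_eq_sub_of_hasDerivAt (fun x _ => h x) (hg.intervalIntegrable _ _)]
  ring

lemma integral (hg : IntegrableOn g (Ioo 0 1)) :
    IsPrimitive (fun x => ∫ t in (0 : ℝ)..x, g t) g :=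
  ⟨hg, fun x _ => by simp⟩

/-- The product rule for absolutely continuous functions. -/
lemma mul (hu : IsPrimitive u g) (hv : IsPrimitive v h) :
    IsPrimitive (fun x => u x * v x) (fun x => g x * v x + u x * h x) := by
  have i1 : IntegrableOn (fun x => g x * v x) (Ioc 0 1) := by
    have := hu.intervalIntegrable.mul_continuousOn
      (by rw [uIcc_of_le zero_le_one]; exact hv.continuousOn)
    exact (intervalIntegrable_iff_integrableOn_Ioc_of_le zero_le_one).1 this
  have i2 : IntegrableOn (fun x => u x * h x) (Ioc 0 1) := by
    have := hv.intervalIntegrable.continuousOn_mul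
      (by rw [uIcc_of_le zero_le_one]; exact hu.continuousOn)
    exact (intervalIntegrable_iff_integrableOn_Ioc_of_le zero_le_one).1 this
  refine ⟨(i1.add i2).mono_set Ioo_subset_Ioc_self, fun y hy => ?_⟩
  have hsub : Ioc 0 y ⊆ Ioc (0 : ℝ) 1 := Ioc_subset_Ioc_right hy.2
  have jg : IntegrableOn g (Ioc 0 y) :=
    ((intervalIntegrable_iff_integrableOn_Ioc_of_le zero_le_one).1
      hu.intervalIntegrable).mono_set hsub
  have jh : IntegrableOn h (Ioc 0 y) :=
    ((intervalIntegrable_iff_integrableOn_Ioc_of_le zero_le_one).1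
      hv.intervalIntegrable).mono_set hsub
  -- Fubini's theorem for `u - u 0` and `v - v 0`; the constants are put back in `k1` and `k2`.
  have key := setIntegral_mul_primitive_add jg jh
  have hu' : ∀ x ∈ Icc (0 : ℝ) 1, ∫ t in Ioc 0 x, g t = u x - u 0 := fun x hx => by
    rw [hu.2 x hx, intervalIntegral.integral_of_le hx.1]; ring
  have hv' : ∀ x ∈ Icc (0 : ℝ) 1, ∫ t in Ioc 0 x, h t = v x - v 0 := fun x hx => by
    rw [hv.2 x hx, intervalIntegral.integral_of_le hx.1]; ring
  have k1 : ∫ x in Ioc 0 y, (g x * ∫ t in Ioc 0 x, h t) =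
      (∫ x in Ioc 0 y, g x * v x) - (∫ x in Ioc 0 y, g x) * v 0 := by
    rw [← integral_mul_const, ← integral_sub (i1.mono_set hsub) (jg.mul_const _)]
    refine setIntegral_congr_fun measurableSet_Ioc fun x hx => ?_
    rw [hv' x ⟨hx.1.le, hx.2.trans hy.2⟩, mul_sub]
  have k2 : ∫ x in Ioc 0 y, ((∫ t in Ioc 0 x, g t) * h x) =
      (∫ x in Ioc 0 y, u x * h x) - u 0 * (∫ x in Ioc 0 y, h x) := by
    rw [← integral_const_mul, ← integral_sub (i2.mono_set hsub) (jh.const_mul _)]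
    refine setIntegral_congr_fun measurableSet_Ioc fun x hx => ?_
    rw [hu' x ⟨hx.1.le, hx.2.trans hy.2⟩, sub_mul]
  rw [k1, k2, hu' y hy, hv' y hy] at key
  simp only
  rw [intervalIntegral.integral_of_le hy.1, integral_add (i1.mono_set hsub) (i2.mono_set hsub)]
  linear_combination -key

lemma eq_of_deriv_eq_zero (hu : IsPrimitive u g) (h0 : ∀ x ∈ Ioo (0 : ℝ) 1, g x = 0) {x : ℝ}
    (hx : x ∈ Icc (0 : ℝ) 1) : u x = u 0 := by
  have := (hu.congr_deriv_on (h' := fun _ => 0) h0).2 x hx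
  simpa using this

lemma integral_eq_sub (hu : IsPrimitive u g) : ∫ x in Ioo (0 : ℝ) 1, g x = u 1 - u 0 := by
  rw [hu.2 1 (by simp), intervalIntegral.integral_of_le zero_le_one, integral_Ioc_eq_integral_Ioo]
  ring

/-- The boundary terms vanish, since test functions are zero at `0` and `1`. -/
lemma isWeakDeriv (hu : IsPrimitive u g) : IsWeakDeriv u g := by
  intro φ h1 h2 h3
  have hφ : IsPrimitive (fun x => (φ x : ℂ)) (fun x => ((deriv φ x : ℝ) : ℂ)) :=
    of_hasDerivAt (fun x => ((h1.differentiable (by simp)).differentiableAt.hasDerivAt).ofReal_comp)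
      (Complex.continuous_ofReal.comp (h1.continuous_deriv (by simp)))
  have z0 : φ 0 = 0 := image_eq_zero_of_notMem_tsupport fun h => by simpa using h3 h
  have z1 : φ 1 = 0 := image_eq_zero_of_notMem_tsupport fun h => by simpa using h3 h
  have key := (hφ.mul hu).integral_eq_sub
  have i1 : IntegrableOn (fun x => ((deriv φ x : ℝ) : ℂ) * u x) (Ioo 0 1) := by
    have hc : ContinuousOn (fun x => ((deriv φ x : ℝ) : ℂ) * u x) (Icc 0 1) :=
      (Complex.continuous_ofReal.comp (h1.continuous_deriv (by simp))).continuousOn.mul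
        hu.continuousOn
    exact (hc.integrableOn_Icc).mono_set Ioo_subset_Icc_self
  have i2 : IntegrableOn (fun x => (φ x : ℂ) * g x) (Ioo 0 1) := by
    obtain ⟨C, hC⟩ := h2.exists_bound_of_continuous h1.continuous
    refine Integrable.bdd_mul hu.1 (Complex.continuous_ofReal.comp
      h1.continuous).aestronglyMeasurable (c := C) (Filter.Eventually.of_forall fun x => ?_)
    simpa using hC x
  rw [integral_add i1 i2, z0, z1] at key
  simp only [Complex.real_smul]
  push_cast at key
  linear_combination key

end IsPrimitive

/-! ### Weak derivatives and absolute continuity -/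

/-- A test function with integral zero is the derivative of a test function. -/
lemma exists_deriv_eq_of_integral_eq_zero {ρ : ℝ → ℝ} (h1 : ContDiff ℝ ∞ ρ)
    (h2 : HasCompactSupport ρ) (h3 : tsupport ρ ⊆ Ioo 0 1) (h0 : ∫ x in Ioo (0 : ℝ) 1, ρ x = 0) :
    ∃ φ : ℝ → ℝ, ContDiff ℝ ∞ φ ∧ HasCompactSupport φ ∧ tsupport φ ⊆ Ioo 0 1 ∧ deriv φ = ρ := by
  obtain ⟨a, b, ha, hb, hab⟩ : ∃ a b : ℝ, 0 < a ∧ b < 1 ∧ tsupport ρ ⊆ Icc a b := by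
    rcases (tsupport ρ).eq_empty_or_nonempty with he | hne
    · exact ⟨1 / 2, 1 / 2, by norm_num, by norm_num, by simp [he]⟩
    · have hc : IsCompact (tsupport ρ) := h2
      exact ⟨sInf (tsupport ρ), sSup (tsupport ρ), (h3 (hc.sInf_mem hne)).1,
        (h3 (hc.sSup_mem hne)).2, fun x hx =>
          ⟨csInf_le hc.bddBelow hx, le_csSup hc.bddAbove hx⟩⟩
  have hz : ∀ x, x ∉ Icc a b → ρ x = 0 := fun x hx =>
    image_eq_zero_of_notMem_tsupport fun h => hx (hab h)
  let φ : ℝ → ℝ := fun x => ∫ t in (0 : ℝ)..x, ρ t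
  have hd : deriv φ = ρ := funext fun x => h1.continuous.deriv_integral ρ 0 x
  have hout : ∀ x, x ∉ Icc a b → φ x = 0 := by
    intro x hx
    by_cases hxa : x < a
    · refine (intervalIntegral.integral_congr (g := fun _ => (0 : ℝ)) fun t ht => hz t ?_).trans
        (by simp)
      intro h
      rcases le_total 0 x with h' | h'
      · rw [uIcc_of_le h'] at ht; linarith [ht.2, h.1]
      · rw [uIcc_of_ge h'] at ht; linarith [ht.2, h.1]
    · have hxb : b < x := by
        by_contra h
        exact hx ⟨not_lt.1 hxa, not_lt.1 h⟩
      have hi : ∀ y z, IntervalIntegrable ρ volume y z :=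
        fun y z => h1.continuous.intervalIntegrable y z
      have e : ∫ t in x..1, ρ t = 0 := by
        refine (intervalIntegral.integral_congr (g := fun _ => (0 : ℝ)) fun t ht => hz t ?_).trans
          (by simp)
        intro h
        rcases le_total x 1 with h' | h'
        · rw [uIcc_of_le h'] at ht; linarith [ht.1, h.2]
        · rw [uIcc_of_ge h'] at ht; linarith [ht.1, h.2]
      have := intervalIntegral.integral_add_adjacent_intervals (hi 0 x) (hi x 1)
      rw [e, add_zero] at this
      simp only [φ]
      rw [this, intervalIntegral.integral_of_le zero_le_one, integral_Ioc_eq_integral_Ioo, h0]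
  have hs : tsupport φ ⊆ Icc a b := by
    refine closure_minimal (fun x hx => ?_) isClosed_Icc
    by_contra h
    exact hx (hout x h)
  refine ⟨φ, contDiff_infty_iff_deriv.2 ⟨fun x =>
    (h1.continuous.integral_hasStrictDerivAt 0 x).hasDerivAt.differentiableAt, by rwa [hd]⟩,
    HasCompactSupport.of_support_subset_isCompact isCompact_Icc (subset_tsupport φ |>.trans hs),
    hs.trans fun x hx => ⟨ha.trans_le hx.1, hx.2.trans_lt hb⟩, hd⟩

/-- The lemma of du Bois-Reymond: a function whose weak derivative vanishes is constant. -/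
lemma IsWeakDeriv.ae_eq_const {w : ℝ → ℂ} (hw : IntegrableOn w (Ioo 0 1))
    (h : IsWeakDeriv w 0) : ∃ k : ℂ, ∀ᵐ x ∂(volume.restrict (Ioo (0 : ℝ) 1)), w x = k := by
  have key : ∀ ψ : ℝ → ℝ, Continuous ψ → HasCompactSupport ψ → ∀ w : ℝ → ℂ,
      IntegrableOn w (Ioo 0 1) → Integrable (fun x => ψ x • w x) (volume.restrict (Ioo 0 1)) := by
    intro ψ c1 c2 w hw
    obtain ⟨C, hC⟩ := c2.exists_bound_of_continuous c1
    exact hw.bdd_smul C c1.aestronglyMeasurable (Filter.Eventually.of_forall hC)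
  have iint : ∀ ψ : ℝ → ℝ, Continuous ψ → IntegrableOn ψ (Ioo 0 1) := fun ψ c =>
    (c.integrableOn_Icc (a := 0) (b := 1)).mono_set Ioo_subset_Icc_self
  let B : ContDiffBump (1 / 2 : ℝ) := ⟨1 / 8, 1 / 4, by norm_num, by norm_num⟩
  -- a test function with integral one
  let ψ₀ : ℝ → ℝ := B.normed volume
  have p1 : ContDiff ℝ ∞ ψ₀ := B.contDiff_normed
  have p2 : HasCompactSupport ψ₀ := B.hasCompactSupport_normed
  have p3 : tsupport ψ₀ ⊆ Ioo 0 1 := by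
    intro x hx
    rw [B.tsupport_normed_eq, Metric.mem_closedBall, Real.dist_eq, abs_le] at hx
    simp only [B] at hx
    constructor <;> linarith [hx.1, hx.2]
  have p4 : ∫ x in Ioo (0 : ℝ) 1, ψ₀ x = 1 := by
    rw [setIntegral_eq_integral_of_forall_compl_eq_zero fun x hx =>
      image_eq_zero_of_notMem_tsupport fun h => hx (p3 h)]
    exact B.integral_normed
  set k : ℂ := ∫ x in Ioo (0 : ℝ) 1, ψ₀ x • w x with hk
  refine ⟨k, ?_⟩
  have hs : IntegrableOn (fun x => w x - k) (Ioo 0 1) := hw.sub (integrableOn_const (by simp))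
  have := isOpen_Ioo.ae_eq_zero_of_integral_contDiff_smul_eq_zero
    (μ := volume.restrict (Ioo (0 : ℝ) 1)) (U := Ioo (0 : ℝ) 1) (f := fun x => w x - k)
    (hs.locallyIntegrable.locallyIntegrableOn _) (by
      intro ψ h1 h2 h3
      set I : ℝ := ∫ x in Ioo (0 : ℝ) 1, ψ x with hI
      have q2 : HasCompactSupport fun x => I * ψ₀ x := p2.mul_left (f := fun _ => I)
      obtain ⟨φ, f1, f2, f3, f4⟩ := exists_deriv_eq_of_integral_eq_zero
        (ρ := ψ - fun x => I * ψ₀ x) (h1.sub (contDiff_const.mul p1)) (h2.sub q2)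
        ((tsupport_sub _ _).trans (union_subset h3
          ((tsupport_mul_subset_right (f := fun _ => I)).trans p3))) (by
          simp only [Pi.sub_apply]
          rw [integral_sub (iint _ h1.continuous) ((iint _ p1.continuous).const_mul I),
            integral_const_mul, p4, ← hI]
          ring)
      have e := h φ f1 f2 f3
      rw [f4] at e
      simp only [Pi.sub_apply, sub_smul, mul_smul, Pi.zero_apply, smul_zero, integral_zero,
        neg_zero] at e
      have i0 : Integrable (fun x => I • ψ₀ x • w x) (volume.restrict (Ioo 0 1)) :=
        (key _ p1.continuous p2 _ hw).smul I
      rw [integral_sub (key _ h1.continuous h2 _ hw) i0, integral_smul, ← hk] at e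
      simp only [smul_sub]
      rw [integral_sub (key _ h1.continuous h2 _ hw) ((iint _ h1.continuous).smul_const k),
        integral_smul_const, ← hI]
      exact e)
  filter_upwards [this, ae_restrict_mem measurableSet_Ioo] with x hx hm
  exact sub_eq_zero.1 (hx hm)

/-- An integrable function with an integrable weak derivative is absolutely continuous. -/
lemma IsWeakDeriv.exists_isPrimitive {f g : ℝ → ℂ} (hf : IntegrableOn f (Ioo 0 1))
    (hg : IntegrableOn g (Ioo 0 1)) (h : IsWeakDeriv f g) :
    ∃ u, IsPrimitive u g ∧ ∀ᵐ x ∂(volume.restrict (Ioo (0 : ℝ) 1)), f x = u x := by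
  have hG := IsPrimitive.integral hg
  have iG : IntegrableOn (fun x => ∫ t in (0 : ℝ)..x, g t) (Ioo 0 1) :=
    hG.continuousOn.integrableOn_Icc.mono_set Ioo_subset_Icc_self
  have hw := (h.add hf hg (iG.smul (-1 : ℂ)) (hg.smul (-1 : ℂ)) (hG.isWeakDeriv.smul (-1))).congr
    (Filter.EventuallyEq.rfl) (g' := 0) (Filter.Eventually.of_forall fun x => by simp)
  obtain ⟨k, hk⟩ := hw.ae_eq_const (hf.add (iG.smul (-1 : ℂ)))
  refine ⟨fun x => k + ∫ t in (0 : ℝ)..x, g t, ⟨hg, fun x _ => by simp⟩, ?_⟩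
  filter_upwards [hk] with x hx
  simp only [Pi.add_apply, Pi.smul_apply, smul_eq_mul] at hx
  linear_combination hx

/-! ### The equation `u'' = -w² u + h` on one edge -/

lemma isPrimitive_cos (w : ℂ) :
    IsPrimitive (fun x => Complex.cos (w * x)) (fun x => -w * Complex.sin (w * x)) := by
  refine IsPrimitive.of_hasDerivAt (fun x => ?_) (by fun_prop)
  have h : HasDerivAt (fun x : ℝ => w * (x : ℂ)) w x := by
    simpa using (Complex.ofRealCLM.hasDerivAt (x := x)).const_mul w
  have h' := (Complex.hasDerivAt_cos (w * x)).comp x h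
  exact h'.congr_deriv (by ring)

lemma isPrimitive_sin (w : ℂ) :
    IsPrimitive (fun x => Complex.sin (w * x)) (fun x => w * Complex.cos (w * x)) := by
  refine IsPrimitive.of_hasDerivAt (fun x => ?_) (by fun_prop)
  have h : HasDerivAt (fun x : ℝ => w * (x : ℂ)) w x := by
    simpa using (Complex.ofRealCLM.hasDerivAt (x := x)).const_mul w
  have h' := (Complex.hasDerivAt_sin (w * x)).comp x h
  exact h'.congr_deriv (by ring)

/-- The solutions of `u'' = -w² u`. The two combinations of `u` and `u'` that are obtained by
rotating the pair `(u, u' / w)` back by the angle `w x` are constant. -/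
lemma IsPrimitive.eq_cos_add_sin {u v : ℝ → ℂ} {w : ℂ} (hw : w ≠ 0) (hu : IsPrimitive u v)
    (hv : IsPrimitive v fun x => -w ^ 2 * u x) {x : ℝ} (hx : x ∈ Icc (0 : ℝ) 1) :
    u x = Complex.cos (w * x) * u 0 + Complex.sin (w * x) * (v 0 / w) ∧
      v x = w * (Complex.cos (w * x) * (v 0 / w) - Complex.sin (w * x) * u 0) := by
  have h1 := ((hu.mul (isPrimitive_cos w)).add
    ((hv.mul (isPrimitive_sin w)).const_mul (-1 / w))).eq_of_deriv_eq_zero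
    (fun t _ => by field_simp; ring) hx
  have h2 := ((hu.mul (isPrimitive_sin w)).add
    ((hv.mul (isPrimitive_cos w)).const_mul (1 / w))).eq_of_deriv_eq_zero
    (fun t _ => by field_simp; ring) hx
  simp only [Complex.ofReal_zero, mul_zero, Complex.cos_zero, Complex.sin_zero, mul_one,
    add_zero, zero_add] at h1 h2
  have h3 := Complex.sin_sq_add_cos_sq (w * x)
  constructor
  · rw [show v 0 / w = 1 / w * v 0 by ring, ← h1, ← h2]
    linear_combination (-u x) * h3
  · rw [show v 0 / w = 1 / w * v 0 by ring, ← h1, ← h2]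
    field_simp
    linear_combination (-v x) * h3

/-- Variation of constants for `u'' = -w² u + h` with zero initial values. -/
lemma exists_isPrimitive_inhomogeneous {h : ℝ → ℂ} (hh : IntegrableOn h (Ioo 0 1)) {w : ℂ}
    (hw : w ≠ 0) :
    ∃ u v, IsPrimitive u v ∧ IsPrimitive v (fun x => -w ^ 2 * u x + h x) ∧ u 0 = 0 ∧ v 0 = 0 := by
  have hc : ∀ f : ℝ → ℂ, Continuous f → IntegrableOn (fun x => f x * h x) (Ioo 0 1) := by
    intro f hf
    have hi : IntervalIntegrable h volume 0 1 :=
      (intervalIntegrable_iff_integrableOn_Ioo_of_le zero_le_one).2 hh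
    exact (intervalIntegrable_iff_integrableOn_Ioo_of_le zero_le_one).1
      (hi.continuousOn_mul hf.continuousOn)
  have hP := IsPrimitive.integral (hc (fun x => Complex.cos (w * x)) (by fun_prop))
  have hQ := IsPrimitive.integral (hc (fun x => Complex.sin (w * x)) (by fun_prop))
  have s := isPrimitive_sin w
  have c := isPrimitive_cos w
  refine ⟨_, _, (((s.mul hP).const_mul (1 / w)).add
    ((c.mul hQ).const_mul (-1 / w))).congr_deriv_on (fun x _ => ?_),
    ((c.mul hP).add (s.mul hQ)).congr_deriv_on (fun x _ => ?_), by simp, by simp⟩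
  · field_simp
    ring
  · have h3 := Complex.sin_sq_add_cos_sq (w * x)
    field_simp
    linear_combination (h x) * h3

/-! ### The operator in terms of pointwise representatives -/

namespace Network

variable {n m : ℕ} (N : Network n m)

lemma memLp_edge {u : ℝ → ℂ} (hu : ContinuousOn u (Icc 0 1)) (j : Fin m) :
    MemLp u 2 (N.edgeMeasure j) := by
  have : IsFiniteMeasure (N.edgeMeasure j) := ⟨by simp [edgeMeasure]⟩
  obtain ⟨C, hC⟩ := isCompact_Icc.exists_bound_of_continuousOn hu
  refine MemLp.of_bound (C := C) ?_ (N.ae_edge_iff.2 ?_)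
  · exact ((hu.mono Ioo_subset_Icc_self).aestronglyMeasurable measurableSet_Ioo).smul_measure _
  · filter_upwards [ae_restrict_mem measurableSet_Ioo] with x hx
    exact hC x (Ioo_subset_Icc_self hx)

/-- The class in `∏_j L²(0,1; μ_j dx)` of a family of functions that are continuous on `[0,1]`. -/
noncomputable def ofFun (F : Fin m → ℝ → ℂ) (hF : ∀ j, ContinuousOn (F j) (Icc 0 1)) : N.X :=
  WithLp.toLp 2 fun j => (N.memLp_edge (hF j) j).toLp (F j)

lemma ofFun_ae {F : Fin m → ℝ → ℂ} (hF : ∀ j, ContinuousOn (F j) (Icc 0 1)) (j : Fin m) :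
    ∀ᵐ x ∂(volume.restrict (Ioo (0 : ℝ) 1)), N.ofFun F hF j x = F j x :=
  N.ae_edge_iff.1 (MemLp.coeFn_toLp (N.memLp_edge (hF j) j))

lemma ext_ae {f g : N.X}
    (h : ∀ j, ∀ᵐ x ∂(volume.restrict (Ioo (0 : ℝ) 1)), f j x = g j x) : f = g := by
  ext1 j
  exact Lp.ext (N.ae_edge_iff.2 (h j))

lemma Φp_transpose_mulVec (d : Fin n → ℂ) : N.Φpᵀ *ᵥ d = fun j => d (N.src j) := by
  ext j
  simp [Matrix.mulVec, dotProduct, Φp]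

lemma Φm_transpose_mulVec (d : Fin n → ℂ) : N.Φmᵀ *ᵥ d = fun j => d (N.tgt j) := by
  ext j
  simp [Matrix.mulVec, dotProduct, Φm]

/-- `A f = g` in terms of pointwise representatives: `u` represents `f`, `v` is the derivative of
`u`, the derivative of `v` is `g / c`, and `u`, `v` satisfy the vertex conditions. -/
structure Solves (f g : N.X) (u v : Fin m → ℝ → ℂ) : Prop where
  rep : ∀ j, ∀ᵐ x ∂(volume.restrict (Ioo (0 : ℝ) 1)), f j x = u j x
  deriv : ∀ j, IsPrimitive (u j) (v j)
  deriv₂ : ∀ j, IsPrimitive (v j) fun x => (N.c j : ℂ)⁻¹ * g j x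
  kirchhoff : (N.Φwp *ᵥ fun j => v j 0) = N.Φwm *ᵥ fun j => v j 1
  cont : ∃ d : Fin n → ℂ, (∀ j, u j 0 = d (N.src j)) ∧ ∀ j, u j 1 = d (N.tgt j)

lemma c_ne_zero (j : Fin m) : (N.c j : ℂ) ≠ 0 := Complex.ofReal_ne_zero.2 (N.c_pos j).ne'

lemma eqOn_of_ae_eq {u v : ℝ → ℂ} (hu : ContinuousOn u (Icc 0 1)) (hv : ContinuousOn v (Icc 0 1))
    (h : ∀ᵐ x ∂(volume.restrict (Ioo (0 : ℝ) 1)), u x = v x) : EqOn u v (Icc 0 1) := by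
  rw [Measure.restrict_congr_set Ioo_ae_eq_Icc] at h
  exact Measure.eqOn_Icc_of_ae_eq volume zero_ne_one h hu hv

/-- The graph of `A`. A function in the domain has absolutely continuous representatives of itself
and of its weak derivative, and they agree on `[0,1]` with the continuous representatives in the
vertex conditions. -/
lemma A_eq_iff (f g : N.X) :
    (∃ h : f ∈ N.A.domain, N.A ⟨f, h⟩ = g) ↔ ∃ u v, N.Solves f g u v := by
  constructor
  · rintro ⟨h, rfl⟩
    obtain ⟨p, q, hd, u', v', hu', hv', hk, d, d0, d1⟩ := id h
    have hA : ∀ j, N.A ⟨f, h⟩ j = (N.c j : ℂ) • q j := fun j => by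
      rw [← N.secondDeriv_eq (f := ⟨f, h⟩) hd]; rfl
    have e1 : ∀ j, ∃ u, IsPrimitive u (p j) ∧ _ := fun j =>
      (hd j).1.exists_isPrimitive (N.integrableOn _) (N.integrableOn _)
    have e2 : ∀ j, ∃ v, IsPrimitive v (q j) ∧ _ := fun j =>
      (hd j).2.exists_isPrimitive (N.integrableOn _) (N.integrableOn _)
    choose u hu fu using e1
    choose v hv pv using e2
    have eu : ∀ j, EqOn (u j) (u' j) (Icc 0 1) := fun j => by
      refine eqOn_of_ae_eq (hu j).continuousOn (hu' j).1 ?_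
      filter_upwards [fu j, (hu' j).2] with x h1 h2
      rw [← h1, h2]
    have ev : ∀ j, EqOn (v j) (v' j) (Icc 0 1) := fun j => by
      refine eqOn_of_ae_eq (hv j).continuousOn (hv' j).1 ?_
      filter_upwards [pv j, (hv' j).2] with x h1 h2
      rw [← h1, h2]
    rw [N.Φp_transpose_mulVec] at d0
    rw [N.Φm_transpose_mulVec] at d1
    refine ⟨u, v, fu, fun j => (hu j).congr_deriv (pv j), fun j => (hv j).congr_deriv ?_, ?_, d,
      fun j => ?_, fun j => ?_⟩
    · rw [hA j]
      filter_upwards [N.ae_edge_iff.1 (Lp.coeFn_smul (N.c j : ℂ) (q j))] with x hx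
      rw [hx, Pi.smul_apply, smul_eq_mul, inv_mul_cancel_left₀ (N.c_ne_zero j)]
    · simpa only [fun j => ev j (show (0 : ℝ) ∈ Icc 0 1 by simp),
        fun j => ev j (show (1 : ℝ) ∈ Icc 0 1 by simp)] using hk
    · rw [eu j (by simp), ← congrFun d0 j]
    · rw [eu j (by simp), ← congrFun d1 j]
  · rintro ⟨u, v, hf, hu, hv, hk, d, d0, d1⟩
    let p : N.X := N.ofFun v fun j => (hv j).continuousOn
    let q : N.X := WithLp.toLp 2 fun j => (N.c j : ℂ)⁻¹ • g j
    have hp := N.ofFun_ae fun j => (hv j).continuousOn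
    have hd : N.IsDerivs f p q := fun j =>
      ⟨(hu j).isWeakDeriv.congr (hf j) (hp j), (hv j).isWeakDeriv.congr (hp j)
        (N.ae_edge_iff.1 (Lp.coeFn_smul (N.c j : ℂ)⁻¹ (g j)))⟩
    have hmem : f ∈ N.domain := by
      refine ⟨p, q, hd, u, v, fun j => ⟨(hu j).continuousOn, hf j⟩,
        fun j => ⟨(hv j).continuousOn, hp j⟩, hk, d, ?_, ?_⟩
      · rw [N.Φp_transpose_mulVec]
        exact funext fun j => (d0 j).symm
      · rw [N.Φm_transpose_mulVec]
        exact funext fun j => (d1 j).symm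
    refine ⟨hmem, ?_⟩
    ext1 j
    change (N.c j : ℂ) • N.secondDeriv ⟨f, hmem⟩ j = g j
    rw [N.secondDeriv_eq (f := ⟨f, hmem⟩) hd]
    exact smul_inv_smul₀ (N.c_ne_zero j) (g j)

/-! ### Green's formula and the kernel -/

lemma inner_eq (f g : N.X) : inner ℂ f g =
    ∑ j, (N.μ j : ℂ) * ∫ x in Ioo (0 : ℝ) 1, (starRingEnd ℂ) (f j x) * g j x := by
  rw [PiLp.inner_apply]
  refine Finset.sum_congr rfl fun j _ => ?_
  rw [L2.inner_def]
  change ∫ x, inner ℂ (f j x) (g j x) ∂(ENNReal.ofReal (N.μ j) • volume.restrict (Ioo 0 1)) = _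
  rw [integral_smul_measure, ENNReal.toReal_ofReal (N.μ_pos j).le,
    Complex.real_smul]
  congr 2
  funext x
  rw [RCLike.inner_apply, mul_comm]

/-- A sum over the edges against vertex values `d` at the initial points is a sum over the
vertices. -/
lemma sum_Φwp (a b : Fin m → ℂ) (d : Fin n → ℂ) (h : ∀ j, a j = d (N.src j)) :
    ∑ j, ((N.μ j * N.c j : ℝ) : ℂ) * (a j * b j) = ∑ i, d i * (N.Φwp *ᵥ b) i := by
  simp only [Matrix.mulVec, dotProduct, Finset.mul_sum]
  rw [Finset.sum_comm]
  refine Finset.sum_congr rfl fun j _ => ?_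
  simp only [Φwp, Matrix.of_apply, ite_mul, zero_mul, mul_ite, mul_zero, Finset.sum_ite_eq,
    Finset.mem_univ, if_true, h]
  ring

/-- A sum over the edges against vertex values `d` at the end points is a sum over the vertices. -/
lemma sum_Φwm (a b : Fin m → ℂ) (d : Fin n → ℂ) (h : ∀ j, a j = d (N.tgt j)) :
    ∑ j, ((N.μ j * N.c j : ℝ) : ℂ) * (a j * b j) = ∑ i, d i * (N.Φwm *ᵥ b) i := by
  simp only [Matrix.mulVec, dotProduct, Finset.mul_sum]
  rw [Finset.sum_comm]
  refine Finset.sum_congr rfl fun j _ => ?_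
  simp only [Φwm, Matrix.of_apply, ite_mul, zero_mul, mul_ite, mul_zero, Finset.sum_ite_eq,
    Finset.mem_univ, if_true, h]
  ring

variable {N}

/-- Green's formula. The boundary terms add up to zero by the vertex conditions. -/
lemma Solves.inner_eq {f g f' g' : N.X} {u v u' v' : Fin m → ℝ → ℂ} (h : N.Solves f g u v)
    (h' : N.Solves f' g' u' v') : inner ℂ f' g =
      -∑ j, ((N.μ j * N.c j : ℝ) : ℂ) *
        ∫ x in Ioo (0 : ℝ) 1, (starRingEnd ℂ) (v' j x) * v j x := by
  have key : ∀ j, (N.μ j : ℂ) * ∫ x in Ioo (0 : ℝ) 1, (starRingEnd ℂ) (f' j x) * g j x =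
      ((N.μ j * N.c j : ℝ) : ℂ) * ((starRingEnd ℂ) (u' j 1) * v j 1) -
      ((N.μ j * N.c j : ℝ) : ℂ) * ((starRingEnd ℂ) (u' j 0) * v j 0) -
      ((N.μ j * N.c j : ℝ) : ℂ) * ∫ x in Ioo (0 : ℝ) 1, (starRingEnd ℂ) (v' j x) * v j x := by
    intro j
    have hP := ((h'.deriv j).conj.mul (h.deriv₂ j))
    have i1 : IntegrableOn (fun x => (starRingEnd ℂ) (v' j x) * v j x) (Ioo 0 1) :=
      (((h'.deriv₂ j).conj.continuousOn.mul (h.deriv₂ j).continuousOn).integrableOn_Icc).mono_set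
        Ioo_subset_Icc_self
    have i2 : IntegrableOn (fun x => (starRingEnd ℂ) (u' j x) * ((N.c j : ℂ)⁻¹ * g j x))
        (Ioo 0 1) := by
      have := hP.1.sub i1
      simpa only [Pi.sub_def, add_sub_cancel_left] using this
    have e := hP.integral_eq_sub
    rw [integral_add i1 i2] at e
    have e2 : ∫ x in Ioo (0 : ℝ) 1, (starRingEnd ℂ) (f' j x) * g j x =
        (N.c j : ℂ) * ∫ x in Ioo (0 : ℝ) 1, (starRingEnd ℂ) (u' j x) * ((N.c j : ℂ)⁻¹ * g j x) := by
      rw [← integral_const_mul]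
      refine integral_congr_ae ((h'.rep j).mono fun x hx => ?_)
      have := N.c_ne_zero j
      simp only [hx]
      field_simp
    rw [e2]
    push_cast
    linear_combination (N.μ j * N.c j : ℂ) * e
  obtain ⟨d, d0, d1⟩ := h'.cont
  rw [N.inner_eq, Finset.sum_congr rfl fun j _ => key j, Finset.sum_sub_distrib,
    Finset.sum_sub_distrib,
    N.sum_Φwp (fun j => (starRingEnd ℂ) (u' j 0)) (fun j => v j 0) (fun i => (starRingEnd ℂ) (d i))
      (fun j => by rw [d0 j]),
    N.sum_Φwm (fun j => (starRingEnd ℂ) (u' j 1)) (fun j => v j 1) (fun i => (starRingEnd ℂ) (d i))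
      (fun j => by rw [d1 j]), h.kirchhoff]
  ring

lemma Solves.inner_symm {f g f' g' : N.X} {u v u' v' : Fin m → ℝ → ℂ} (h : N.Solves f g u v)
    (h' : N.Solves f' g' u' v') : inner ℂ f' g = inner ℂ g' f := by
  rw [← inner_conj_symm g' f, h.inner_eq h', h'.inner_eq h]
  simp only [map_neg, map_sum, map_mul, Complex.conj_ofReal, ← integral_conj, Complex.conj_conj]
  simp only [mul_comm]

lemma Solves.inner_self {f g : N.X} {u v : Fin m → ℝ → ℂ} (h : N.Solves f g u v) :
    inner ℂ f g = ((-∑ j, N.μ j * N.c j * ∫ x in Ioo (0 : ℝ) 1, ‖v j x‖ ^ 2 : ℝ) : ℂ) := by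
  rw [h.inner_eq h]
  push_cast
  congr 1
  refine Finset.sum_congr rfl fun j _ => ?_
  congr 1
  rw [← integral_complex_ofReal]
  refine integral_congr_ae (Filter.Eventually.of_forall fun x => ?_)
  simp only [Complex.conj_mul', Complex.ofReal_pow]

variable (N)

lemma A_inner_symm (f g : N.A.domain) :
    inner ℂ (g : N.X) (N.A f) = inner ℂ (N.A g) (f : N.X) := by
  obtain ⟨u, v, h⟩ := (N.A_eq_iff f (N.A f)).1 ⟨f.2, rfl⟩
  obtain ⟨u', v', h'⟩ := (N.A_eq_iff g (N.A g)).1 ⟨g.2, rfl⟩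
  exact h.inner_symm h'

/-- The operator is symmetric and negative, so its eigenvalues are real and nonpositive. -/
lemma exists_eq_neg_of_isEigenval {z : ℂ} (h : IsEigenval N.A z) :
    ∃ l : ℝ, 0 ≤ l ∧ z = ((-l : ℝ) : ℂ) := by
  obtain ⟨f, hf, hm, he⟩ := h
  obtain ⟨u, v, h⟩ := (N.A_eq_iff f (z • f)).1 ⟨hm, he⟩
  have e := h.inner_self
  rw [inner_smul_right, inner_self_eq_norm_sq_to_K] at e
  have hn : (0 : ℝ) < ‖f‖ ^ 2 := by positivity
  refine ⟨(∑ j, N.μ j * N.c j * ∫ x in Ioo (0 : ℝ) 1, ‖v j x‖ ^ 2) / ‖f‖ ^ 2, ?_, ?_⟩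
  · exact div_nonneg (Finset.sum_nonneg fun j _ => mul_nonneg
      (mul_nonneg (N.μ_pos j).le (N.c_pos j).le) (integral_nonneg fun x => by positivity)) hn.le
  · have hn' : ((‖f‖ : ℝ) : ℂ) ^ 2 ≠ 0 := by exact_mod_cast hn.ne'
    push_cast at e ⊢
    rw [← neg_div, eq_div_iff hn']
    exact e

lemma exists_edge {i k : Fin n} (h : N.graph.Adj i k) :
    ∃ j, (N.src j = i ∧ N.tgt j = k) ∨ (N.src j = k ∧ N.tgt j = i) := by
  obtain ⟨j, hj, -⟩ := N.edge_bij s(i, k) h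
  exact ⟨j, by simpa using hj⟩

lemma exists_edge_at (i : Fin n) : ∃ j, N.src j = i ∨ N.tgt j = i := by
  have h := N.two_le_degree i
  obtain ⟨k, hk⟩ : (N.graph.neighborSet i).Nonempty := by
    rw [← Set.ncard_pos]; omega
  obtain ⟨j, hj⟩ := N.exists_edge hk
  exact ⟨j, by tauto⟩

lemma src_ne_tgt (j : Fin m) : N.src j ≠ N.tgt j := fun h => by
  have := N.edge_mem j
  rw [h] at this
  simp at this

lemma nonempty_edges (N : Network n m) : Nonempty (Fin m) := by
  obtain ⟨i⟩ := N.connected.nonempty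
  exact ⟨(N.exists_edge_at i).choose⟩

/-- A function on the vertices that agrees at the two ends of every edge is constant. -/
lemma eq_of_src_eq_tgt {d : Fin n → ℂ} (h : ∀ j, d (N.src j) = d (N.tgt j)) (i k : Fin n) :
    d i = d k := by
  obtain ⟨w⟩ := N.connected.preconnected i k
  induction w with
  | nil => rfl
  | cons ha _ ih =>
    obtain ⟨j, ⟨h1, h2⟩ | ⟨h1, h2⟩⟩ := N.exists_edge ha
    · rw [← ih, ← h1, ← h2, h j]
    · rw [← ih, ← h1, ← h2, h j]

/-- The constant function `1`. -/
noncomputable def one : N.X := N.ofFun (fun _ _ => 1) fun _ => continuousOn_const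

lemma isPrimitive_const (a : ℂ) : IsPrimitive (fun _ => a) (fun _ => 0) :=
  ⟨integrableOn_zero, fun x _ => by simp⟩

lemma A_one : ∃ h : N.one ∈ N.A.domain, N.A ⟨N.one, h⟩ = 0 := by
  refine (N.A_eq_iff _ _).2 ⟨fun _ _ => 1, fun _ _ => 0, N.ofFun_ae _,
    fun j => isPrimitive_const 1, fun j => (isPrimitive_const 0).congr_deriv ?_, ?_,
    fun _ => 1, fun _ => rfl, fun _ => rfl⟩
  · filter_upwards [N.ae_edge_iff.1 (Lp.coeFn_zero ℂ 2 (N.edgeMeasure j))] with x hx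
    simp only [PiLp.zero_apply, hx, Pi.zero_apply, mul_zero]
  · exact (Matrix.mulVec_zero _).trans (Matrix.mulVec_zero _).symm

lemma one_ne_zero : N.one ≠ 0 := by
  obtain ⟨j⟩ := N.nonempty_edges
  intro h
  have h1 := N.ofFun_ae (F := fun _ _ => 1) (fun _ => continuousOn_const) j
  have h2 := N.ae_edge_iff.1 (Lp.coeFn_zero ℂ 2 (N.edgeMeasure j))
  change ∀ᵐ x ∂_, N.one j x = 1 at h1
  rw [h] at h1
  have h3 : ∀ᵐ x ∂(volume.restrict (Ioo (0 : ℝ) 1)), False := by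
    filter_upwards [h1, h2] with x a b
    simp only [PiLp.zero_apply, b, Pi.zero_apply] at a
    exact zero_ne_one a
  rw [Filter.eventually_false_iff_eq_bot, ae_eq_bot, Measure.restrict_eq_zero] at h3
  simp at h3

/-- Since `⟪f, A f⟫ = -∑ μ_j c_j ∫ |f_j'|²`, a function in the kernel is constant on each edge. -/
lemma eq_smul_one_of_A_eq_zero {f : N.X} (h : ∃ h : f ∈ N.A.domain, N.A ⟨f, h⟩ = 0) :
    ∃ a : ℂ, f = a • N.one := by
  obtain ⟨u, v, h⟩ := (N.A_eq_iff f 0).1 h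
  have hc : ∀ j, ∀ x ∈ Icc (0 : ℝ) 1, v j x = v j 0 := fun j x hx => by
    refine IsPrimitive.eq_of_deriv_eq_zero ((h.deriv₂ j).congr_deriv (h' := fun _ => 0) ?_)
      (fun _ _ => rfl) hx
    filter_upwards [N.ae_edge_iff.1 (Lp.coeFn_zero ℂ 2 (N.edgeMeasure j))] with x hx
    simp only [PiLp.zero_apply, hx, Pi.zero_apply, mul_zero]
  have e := h.inner_self
  have e2 : ∀ j, ∫ x in Ioo (0 : ℝ) 1, ‖v j x‖ ^ 2 = ‖v j 0‖ ^ 2 := fun j => by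
    rw [setIntegral_congr_fun (g := fun _ => ‖v j 0‖ ^ 2) measurableSet_Ioo
      (fun x hx => by simp only [hc j x (Ioo_subset_Icc_self hx)])]
    simp
  rw [inner_zero_right] at e
  simp only [e2] at e
  norm_cast at e
  have e3 := (Finset.sum_eq_zero_iff_of_nonneg fun j _ => mul_nonneg (mul_nonneg (N.μ_pos j).le
    (N.c_pos j).le) (sq_nonneg ‖v j 0‖)).1 (neg_eq_zero.1 e.symm)
  have hv : ∀ j, v j 0 = 0 := fun j => by
    simpa [(N.μ_pos j).ne', (N.c_pos j).ne'] using e3 j (Finset.mem_univ j)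
  have hu : ∀ j, ∀ x ∈ Icc (0 : ℝ) 1, u j x = u j 0 := fun j x hx =>
    (h.deriv j).eq_of_deriv_eq_zero
      (fun t ht => (hc j t (Ioo_subset_Icc_self ht)).trans (hv j)) hx
  obtain ⟨d, d0, d1⟩ := h.cont
  have hd := N.eq_of_src_eq_tgt (d := d) fun j => by rw [← d0, ← d1, hu j 1 (by simp)]
  obtain ⟨i⟩ := N.connected.nonempty
  refine ⟨d i, N.ext_ae fun j => ?_⟩
  filter_upwards [h.rep j, N.ofFun_ae (F := fun _ _ => 1) (fun _ => continuousOn_const) j,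
    N.ae_edge_iff.1 (Lp.coeFn_smul (d i) (N.one j)), ae_restrict_mem measurableSet_Ioo]
    with x h1 h2 h3 h4
  change N.one j x = 1 at h2
  rw [PiLp.smul_apply, h3, h1, hu j x (Ioo_subset_Icc_self h4), d0, Pi.smul_apply, h2,
    hd (N.src j) i, smul_eq_mul, mul_one]

end Network

/-! ### The square linear system for the eigenfunctions -/

namespace Network

variable {n m : ℕ} (N : Network n m)

/-- The frequency `W / √c_j` of the solutions of `c_j u'' = -W² u` on the `j`-th edge. -/
noncomputable def freq (W : ℂ) (j : Fin m) : ℂ := W / (Real.sqrt (N.c j) : ℂ)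

/-- The solution of `c_j u'' = -W² u` on the `j`-th edge with the value `d (src j)` and the
derivative `freq W j * b j` at `0`, for the parameters `p = (b, d)`. -/
noncomputable def sol (W : ℂ) (p : (Fin m → ℂ) × (Fin n → ℂ)) (j : Fin m) (x : ℝ) : ℂ :=
  Complex.cos (N.freq W j * x) * p.2 (N.src j) + Complex.sin (N.freq W j * x) * p.1 j

/-- The derivative of `sol`. -/
noncomputable def solDeriv (W : ℂ) (p : (Fin m → ℂ) × (Fin n → ℂ)) (j : Fin m) (x : ℝ) : ℂ :=
  N.freq W j *
    (Complex.cos (N.freq W j * x) * p.1 j - Complex.sin (N.freq W j * x) * p.2 (N.src j))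

lemma sqrt_c_ne_zero (j : Fin m) : (Real.sqrt (N.c j) : ℂ) ≠ 0 :=
  Complex.ofReal_ne_zero.2 (Real.sqrt_pos.2 (N.c_pos j)).ne'

lemma sqrt_c_sq (j : Fin m) : (Real.sqrt (N.c j) : ℂ) ^ 2 = N.c j := by
  exact_mod_cast Real.sq_sqrt (N.c_pos j).le

lemma freq_ne_zero {W : ℂ} (hW : W ≠ 0) (j : Fin m) : N.freq W j ≠ 0 :=
  div_ne_zero hW (N.sqrt_c_ne_zero j)

lemma freq_sq (W : ℂ) (j : Fin m) : N.freq W j ^ 2 = (N.c j : ℂ)⁻¹ * W ^ 2 := by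
  rw [freq, div_pow, N.sqrt_c_sq, div_eq_inv_mul]

lemma isPrimitive_sol (W : ℂ) (p : (Fin m → ℂ) × (Fin n → ℂ)) (j : Fin m) :
    IsPrimitive (N.sol W p j) (N.solDeriv W p j) := by
  refine ((((isPrimitive_cos (N.freq W j)).const_mul (p.2 (N.src j))).add
    ((isPrimitive_sin (N.freq W j)).const_mul (p.1 j))).congr_deriv_on fun x _ => ?_).congr_fun
      fun x _ => ?_
  · simp only [solDeriv]; ring
  · simp only [sol]; ring

lemma isPrimitive_solDeriv (W : ℂ) (p : (Fin m → ℂ) × (Fin n → ℂ)) (j : Fin m) :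
    IsPrimitive (N.solDeriv W p j) (fun x => -N.freq W j ^ 2 * N.sol W p j x) := by
  refine ((((isPrimitive_cos (N.freq W j)).const_mul (N.freq W j * p.1 j)).add
    ((isPrimitive_sin (N.freq W j)).const_mul
      (-N.freq W j * p.2 (N.src j)))).congr_deriv_on fun x _ => ?_).congr_fun fun x _ => ?_
  · simp only [sol]; ring
  · simp only [solDeriv]; ring

lemma sol_zero (W : ℂ) (p : (Fin m → ℂ) × (Fin n → ℂ)) (j : Fin m) :
    N.sol W p j 0 = p.2 (N.src j) := by simp [sol]

lemma solDeriv_zero (W : ℂ) (p : (Fin m → ℂ) × (Fin n → ℂ)) (j : Fin m) :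
    N.solDeriv W p j 0 = N.freq W j * p.1 j := by simp [solDeriv]

lemma sol_add (W : ℂ) (p q : (Fin m → ℂ) × (Fin n → ℂ)) (j : Fin m) (x : ℝ) :
    N.sol W (p + q) j x = N.sol W p j x + N.sol W q j x := by
  simp only [sol, Prod.fst_add, Prod.snd_add, Pi.add_apply]; ring

lemma sol_smul (W a : ℂ) (p : (Fin m → ℂ) × (Fin n → ℂ)) (j : Fin m) (x : ℝ) :
    N.sol W (a • p) j x = a * N.sol W p j x := by
  simp only [sol, Prod.smul_fst, Prod.smul_snd, Pi.smul_apply, smul_eq_mul]; ring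

lemma solDeriv_add (W : ℂ) (p q : (Fin m → ℂ) × (Fin n → ℂ)) (x : ℝ) :
    (fun j => N.solDeriv W (p + q) j x) =
      (fun j => N.solDeriv W p j x) + fun j => N.solDeriv W q j x := by
  ext j
  simp only [solDeriv, Prod.fst_add, Prod.snd_add, Pi.add_apply]; ring

lemma solDeriv_smul (W a : ℂ) (p : (Fin m → ℂ) × (Fin n → ℂ)) (x : ℝ) :
    (fun j => N.solDeriv W (a • p) j x) = a • fun j => N.solDeriv W p j x := by
  ext j
  simp only [solDeriv, Prod.smul_fst, Prod.smul_snd, Pi.smul_apply, smul_eq_mul]; ring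

/-- The vertex conditions for `sol W (b, d)` as a square linear system for `(b, d)`: continuity at
the end points of the edges, and the Kirchhoff law. -/
noncomputable def vertexMap (W : ℂ) :
    ((Fin m → ℂ) × (Fin n → ℂ)) →ₗ[ℂ] ((Fin m → ℂ) × (Fin n → ℂ)) where
  toFun p := (fun j => N.sol W p j 1 - p.2 (N.tgt j),
    (N.Φwm *ᵥ fun j => N.solDeriv W p j 1) - N.Φwp *ᵥ fun j => N.solDeriv W p j 0)
  map_add' p q := by
    refine Prod.ext (funext fun j => ?_) ?_
    · simp only [sol_add, Prod.fst_add, Prod.snd_add, Pi.add_apply]; ring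
    · simp only [solDeriv_add, Matrix.mulVec_add, Prod.snd_add]; abel
  map_smul' a p := by
    refine Prod.ext (funext fun j => ?_) ?_
    · simp only [sol_smul, Prod.smul_fst, Prod.smul_snd, Pi.smul_apply, smul_eq_mul,
        RingHom.id_apply]
      ring
    · simp only [solDeriv_smul, Matrix.mulVec_smul, Prod.smul_snd, RingHom.id_apply, smul_sub]

lemma vertexMap_eq_iff (W : ℂ) (p q : (Fin m → ℂ) × (Fin n → ℂ)) :
    N.vertexMap W p = q ↔ (∀ j, N.sol W p j 1 - p.2 (N.tgt j) = q.1 j) ∧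
      (N.Φwm *ᵥ fun j => N.solDeriv W p j 1) - (N.Φwp *ᵥ fun j => N.solDeriv W p j 0) = q.2 := by
  rw [Prod.ext_iff, funext_iff]
  rfl

/-- The element of `X` that is given by `sol W p`. -/
noncomputable def edgeFun (W : ℂ) : ((Fin m → ℂ) × (Fin n → ℂ)) →ₗ[ℂ] N.X where
  toFun p := N.ofFun (N.sol W p) fun j => (N.isPrimitive_sol W p j).continuousOn
  map_add' p q := by
    refine N.ext_ae fun j => ?_
    filter_upwards [N.ofFun_ae (fun j => (N.isPrimitive_sol W (p + q) j).continuousOn) j,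
      N.ofFun_ae (fun j => (N.isPrimitive_sol W p j).continuousOn) j,
      N.ofFun_ae (fun j => (N.isPrimitive_sol W q j).continuousOn) j,
      N.ae_edge_iff.1 (Lp.coeFn_add
        (N.ofFun (N.sol W p) (fun j => (N.isPrimitive_sol W p j).continuousOn) j)
        (N.ofFun (N.sol W q) (fun j => (N.isPrimitive_sol W q j).continuousOn) j))]
      with x h1 h2 h3 h4
    rw [PiLp.add_apply, h4, Pi.add_apply, h1, h2, h3, N.sol_add]
  map_smul' a p := by
    refine N.ext_ae fun j => ?_
    filter_upwards [N.ofFun_ae (fun j => (N.isPrimitive_sol W (a • p) j).continuousOn) j,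
      N.ofFun_ae (fun j => (N.isPrimitive_sol W p j).continuousOn) j,
      N.ae_edge_iff.1 (Lp.coeFn_smul a
        (N.ofFun (N.sol W p) (fun j => (N.isPrimitive_sol W p j).continuousOn) j))]
      with x h1 h2 h3
    rw [RingHom.id_apply, PiLp.smul_apply, h3, Pi.smul_apply, h1, h2, N.sol_smul, smul_eq_mul]

lemma edgeFun_ae (W : ℂ) (p : (Fin m → ℂ) × (Fin n → ℂ)) (j : Fin m) :
    ∀ᵐ x ∂(volume.restrict (Ioo (0 : ℝ) 1)), N.edgeFun W p j x = N.sol W p j x :=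
  N.ofFun_ae (fun j => (N.isPrimitive_sol W p j).continuousOn) j

/-- The eigenfunctions for `-W²` are given by the kernel of the square system. -/
lemma A_eq_smul_iff {W : ℂ} (hW : W ≠ 0) (f : N.X) :
    (∃ h : f ∈ N.A.domain, N.A ⟨f, h⟩ = (-W ^ 2) • f) ↔
      ∃ p, N.vertexMap W p = 0 ∧ f = N.edgeFun W p := by
  have hsm : ∀ j, ∀ᵐ x ∂(volume.restrict (Ioo (0 : ℝ) 1)),
      ((-W ^ 2) • f) j x = -W ^ 2 * f j x := fun j =>
    N.ae_edge_iff.1 (Lp.coeFn_smul (-W ^ 2) (f j))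
  rw [N.A_eq_iff]
  constructor
  · rintro ⟨u, v, h⟩
    obtain ⟨d, d0, d1⟩ := h.cont
    have hv : ∀ j, IsPrimitive (v j) (fun x => -N.freq W j ^ 2 * u j x) := fun j => by
      refine (h.deriv₂ j).congr_deriv ?_
      filter_upwards [h.rep j, hsm j] with x h1 h2
      rw [h2, h1, N.freq_sq]
      ring
    have key := fun j x hx => IsPrimitive.eq_cos_add_sin (x := x) (N.freq_ne_zero hW j)
      (h.deriv j) (hv j) hx
    let p : (Fin m → ℂ) × (Fin n → ℂ) := (fun j => v j 0 / N.freq W j, d)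
    have hu : ∀ j, ∀ x ∈ Icc (0 : ℝ) 1, u j x = N.sol W p j x := fun j x hx => by
      rw [(key j x hx).1, d0]; rfl
    have hv' : ∀ j, ∀ x ∈ Icc (0 : ℝ) 1, v j x = N.solDeriv W p j x := fun j x hx => by
      rw [(key j x hx).2, d0]; rfl
    refine ⟨p, (N.vertexMap_eq_iff _ _ _).2 ⟨fun j => ?_, ?_⟩, N.ext_ae fun j => ?_⟩
    · rw [← hu j 1 (by simp), d1 j]
      exact sub_self _
    · simp only [← hv' _ 1 (show (1 : ℝ) ∈ Icc 0 1 by simp),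
        ← hv' _ 0 (show (0 : ℝ) ∈ Icc 0 1 by simp), h.kirchhoff, sub_self]
      rfl
    · filter_upwards [h.rep j, N.edgeFun_ae W p j, ae_restrict_mem measurableSet_Ioo]
        with x h1 h2 h3
      rw [h1, h2, hu j x (Ioo_subset_Icc_self h3)]
  · rintro ⟨p, hp, rfl⟩
    obtain ⟨h1, h2⟩ := (N.vertexMap_eq_iff _ _ _).1 hp
    refine ⟨N.sol W p, N.solDeriv W p, N.edgeFun_ae W p, N.isPrimitive_sol W p,
      fun j => (N.isPrimitive_solDeriv W p j).congr_deriv ?_, (sub_eq_zero.1 h2).symm,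
      p.2, N.sol_zero W p, fun j => sub_eq_zero.1 (h1 j)⟩
    filter_upwards [hsm j, N.edgeFun_ae W p j] with x e1 e2
    rw [e1, e2, N.freq_sq]
    ring

/-- On each edge `cos (w x)` and `sin (w x)` are linearly independent, as `w ≠ 0`. -/
lemma edgeFun_eq_zero {W : ℂ} (hW : W ≠ 0) {p : (Fin m → ℂ) × (Fin n → ℂ)}
    (h : N.edgeFun W p = 0) : (∀ j, p.2 (N.src j) = 0) ∧ p.1 = 0 := by
  have h0 : ∀ j, ∀ x ∈ Icc (0 : ℝ) 1, N.sol W p j x = 0 := fun j => by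
    refine eqOn_of_ae_eq (N.isPrimitive_sol W p j).continuousOn continuousOn_const ?_
    filter_upwards [N.edgeFun_ae W p j,
      N.ae_edge_iff.1 (Lp.coeFn_zero ℂ 2 (N.edgeMeasure j))] with x h1 h2
    rw [← h1, h, PiLp.zero_apply, h2, Pi.zero_apply]
  have hd : ∀ j, p.2 (N.src j) = 0 := fun j => by rw [← N.sol_zero W p j, h0 j 0 (by simp)]
  refine ⟨hd, funext fun j => ?_⟩
  by_contra hb
  have hs : ∀ x ∈ Icc (0 : ℝ) 1, Complex.sin (N.freq W j * x) = 0 := fun x hx => by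
    have := h0 j x hx
    rw [sol, hd, mul_zero, zero_add] at this
    exact (mul_eq_zero.1 this).resolve_right hb
  -- If `sin (w x)` vanishes on `[0,1]`, then the derivative of `sin (w x) * cos (w x)` is `w`.
  have e := (((isPrimitive_sin (N.freq W j)).mul
    (isPrimitive_cos (N.freq W j))).congr_deriv_on (h' := fun _ => N.freq W j) fun x hx => by
      have h1 := hs x (Ioo_subset_Icc_self hx)
      have h2 := Complex.sin_sq_add_cos_sq (N.freq W j * x)
      rw [h1] at h2 ⊢
      linear_combination (N.freq W j) * h2).integral_eq_sub
  rw [hs 1 (by simp), hs 0 (by simp)] at e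
  simp at e
  exact N.freq_ne_zero hW j e

/-- Every vertex is an end point of some edge, so the vertex values are determined by the function
on the edges. -/
lemma eq_zero_of_continuous_of_edgeFun {W : ℂ} (hW : W ≠ 0) {p : (Fin m → ℂ) × (Fin n → ℂ)}
    (h : ∀ j, N.sol W p j 1 = p.2 (N.tgt j)) (h' : N.edgeFun W p = 0) : p = 0 := by
  obtain ⟨hd, hb⟩ := N.edgeFun_eq_zero hW h'
  have ht : ∀ j, p.2 (N.tgt j) = 0 := fun j => by rw [← h j, sol, hd, hb]; simp
  refine Prod.ext hb (funext fun i => ?_)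
  obtain ⟨j, rfl | rfl⟩ := N.exists_edge_at i
  · exact hd j
  · exact ht j

lemma isEigenvec_iff {W : ℂ} (hW : W ≠ 0) (f : N.X) :
    IsEigenvec N.A (-W ^ 2) f ↔ ∃ p, p ≠ 0 ∧ N.vertexMap W p = 0 ∧ f = N.edgeFun W p := by
  rw [IsEigenvec, N.A_eq_smul_iff hW]
  constructor
  · rintro ⟨h0, p, hp, rfl⟩
    exact ⟨p, fun h => h0 (by rw [h, map_zero]), hp, rfl⟩
  · rintro ⟨p, h0, hp, rfl⟩
    refine ⟨fun h => h0 ?_, p, hp, rfl⟩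
    exact N.eq_zero_of_continuous_of_edgeFun hW
      (fun j => sub_eq_zero.1 (((N.vertexMap_eq_iff _ _ _).1 hp).1 j)) h

/-- If `-W² ≠ 0` is not an eigenvalue, then `-W² - A` is onto: a particular solution on the edges
is corrected by a solution of the square system, which is injective and hence surjective. -/
lemma exists_sub_A_eq {W : ℂ} (hW : W ≠ 0) (hev : ¬ IsEigenval N.A (-W ^ 2)) (g : N.X) :
    ∃ f : N.A.domain, (-W ^ 2) • (f : N.X) - N.A f = g := by
  have hinj : Function.Injective (N.vertexMap W) := by
    rw [injective_iff_map_eq_zero]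
    intro p hp
    by_contra h0
    exact hev ⟨_, (N.isEigenvec_iff hW _).2 ⟨p, h0, hp, rfl⟩⟩
  have hsurj := LinearMap.injective_iff_surjective.1 hinj
  have hg : ∀ j, IntegrableOn (fun x => -(N.c j : ℂ)⁻¹ * g j x) (Ioo 0 1) := fun j =>
    (N.integrableOn (g j)).const_mul _
  choose y y' hy hy' y0 y0' using fun j =>
    exists_isPrimitive_inhomogeneous (hg j) (N.freq_ne_zero hW j)
  obtain ⟨p, hp⟩ := hsurj (fun j => -y j 1, -(N.Φwm *ᵥ fun j => y' j 1))
  obtain ⟨h1, h2⟩ := (N.vertexMap_eq_iff _ _ _).1 hp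
  have hu : ∀ j, IsPrimitive (fun x => N.sol W p j x + y j x)
      (fun x => N.solDeriv W p j x + y' j x) := fun j => (N.isPrimitive_sol W p j).add (hy j)
  let f : N.X := N.ofFun (fun j x => N.sol W p j x + y j x) fun j => (hu j).continuousOn
  have hf := N.ofFun_ae fun j => (hu j).continuousOn
  have hmem : ∃ h : f ∈ N.A.domain, N.A ⟨f, h⟩ = (-W ^ 2) • f - g := by
    refine (N.A_eq_iff _ _).2 ⟨_, _, hf, hu, fun j =>
      ((N.isPrimitive_solDeriv W p j).add (hy' j)).congr_deriv ?_, ?_, p.2, fun j => ?_, fun j => ?_⟩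
    · filter_upwards [hf j, N.ae_edge_iff.1 (Lp.coeFn_sub (((-W ^ 2) • f) j) (g j)),
        N.ae_edge_iff.1 (Lp.coeFn_smul (-W ^ 2) (f j))] with x e1 e2 e3
      change N.ofFun _ _ j x = _ at e1
      rw [PiLp.sub_apply, e2, Pi.sub_apply, PiLp.smul_apply, e3, Pi.smul_apply, e1, N.freq_sq,
        smul_eq_mul]
      ring
    · have e1 : (fun j => N.solDeriv W p j 1 + y' j 1) =
        (fun j => N.solDeriv W p j 1) + fun j => y' j 1 := rfl
      simp only [y0', add_zero]
      rw [e1, Matrix.mulVec_add]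
      linear_combination (exp := 1) -h2
    · rw [N.sol_zero, y0, add_zero]
    · linear_combination h1 j
  obtain ⟨hm, he⟩ := hmem
  exact ⟨⟨f, hm⟩, by rw [he]; exact sub_sub_cancel _ _⟩

end Network

/-! ### Resolvents and generalized eigenvectors of symmetric operators -/

section Operators

variable {E : Type*} [NormedAddCommGroup E] [InnerProductSpace ℂ E] [CompleteSpace E]

/-- For a symmetric operator `T` such that `z - T` is bijective and `conj z - T` is onto, the
inverse of `z - T` is bounded. Its graph is closed: if `g_k → g` and `(z - T)⁻¹ g_k → y`, then
`y - (z - T)⁻¹ g` is orthogonal to the range of `conj z - T`. -/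
lemma notMem_opSpectrum_of_symmetric (T : E →ₗ.[ℂ] E)
    (hT : ∀ f g : T.domain, inner ℂ (g : E) (T f) = inner ℂ (T g) (f : E)) {z : ℂ}
    (hinj : ¬ IsEigenval T z) (h1 : ∀ g : E, ∃ f : T.domain, z • (f : E) - T f = g)
    (h2 : ∀ g : E, ∃ f : T.domain, (starRingEnd ℂ) z • (f : E) - T f = g) :
    z ∉ opSpectrum T := by
  let S : T.domain →ₗ[ℂ] E := z • T.domain.subtype - T.toFun
  have hS : ∀ f : T.domain, S f = z • (f : E) - T f := fun f => rfl
  have hbij : Function.Bijective S := by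
    refine ⟨(injective_iff_map_eq_zero S).2 fun f hf => ?_, h1⟩
    by_contra h0
    rw [hS, sub_eq_zero] at hf
    exact hinj ⟨f, fun h => h0 (Subtype.ext h), f.2, hf.symm⟩
  let e := LinearEquiv.ofBijective S hbij
  let R : E →ₗ[ℂ] E := T.domain.subtype ∘ₗ e.symm.toLinearMap
  have hR : ∀ g, z • (e.symm g : E) - T (e.symm g) = g := fun g => e.apply_symm_apply g
  have hinner : ∀ (f : T.domain) (g : E), inner ℂ ((starRingEnd ℂ) z • (f : E) - T f) (R g) =
      inner ℂ (f : E) g := fun f g => by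
    conv_rhs => rw [← hR g]
    rw [inner_sub_left, inner_sub_right, inner_smul_left, inner_smul_right, hT, Complex.conj_conj]
    rfl
  have hcont : Continuous R := by
    refine R.continuous_of_seq_closed_graph fun s x y hs hRs => ?_
    obtain ⟨f, hf⟩ := h2 (y - R x)
    have l1 := (tendsto_const_nhds (x := (starRingEnd ℂ) z • (f : E) - T f)).inner (𝕜 := ℂ) hRs
    have l2 := (tendsto_const_nhds (x := (f : E))).inner (𝕜 := ℂ) hs
    simp only [Function.comp_apply, hinner] at l1
    have := tendsto_nhds_unique l1 l2
    rw [← hinner, ← sub_eq_zero, ← inner_sub_right, hf] at this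
    exact sub_eq_zero.1 (inner_self_eq_zero.1 this)
  intro hz
  refine hz ⟨⟨R, hcont⟩, fun g => ⟨(e.symm g).2, hR g⟩, fun f => ?_⟩
  exact congrArg Subtype.val (e.symm_apply_apply f)

end Operators

section Operators

variable {E : Type*} [NormedAddCommGroup E] [InnerProductSpace ℂ E] (T : E →ₗ.[ℂ] E)

lemma mem_kerPow_succ {z : ℂ} {k : ℕ} {f : E} :
    f ∈ kerPow T z (k + 1) ↔ ∃ h : f ∈ T.domain, T ⟨f, h⟩ - z • f ∈ kerPow T z k := by
  simp only [kerPow, Submodule.mem_map, Submodule.mem_comap]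
  constructor
  · rintro ⟨y, hy, rfl⟩
    exact ⟨y.2, hy⟩
  · rintro ⟨h, hf⟩
    exact ⟨⟨f, h⟩, hf, rfl⟩

lemma mem_kerPow_one {z : ℂ} {f : E} :
    f ∈ kerPow T z 1 ↔ ∃ h : f ∈ T.domain, T ⟨f, h⟩ = z • f := by
  rw [mem_kerPow_succ]
  simp only [kerPow, Submodule.mem_bot, sub_eq_zero]

lemma isEigenvec_iff_mem_kerPow_one {z : ℂ} {f : E} :
    IsEigenvec T z f ↔ f ≠ 0 ∧ f ∈ kerPow T z 1 := by
  rw [mem_kerPow_one, IsEigenvec]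

/-- A symmetric operator has no proper generalized eigenvectors for real `z`, because
`‖(T - z) f‖² = ⟪f, (T - z)² f⟫`. -/
lemma iSup_kerPow_of_symmetric
    (hT : ∀ f g : T.domain, inner ℂ (g : E) (T f) = inner ℂ (T g) (f : E)) (z : ℝ) :
    ⨆ k, kerPow T (z : ℂ) k = kerPow T (z : ℂ) 1 := by
  refine le_antisymm (iSup_le fun k => ?_) (le_iSup (kerPow T (z : ℂ)) 1)
  induction k with
  | zero => exact bot_le
  | succ k ih =>
    intro f hf
    obtain ⟨h, hf⟩ := (mem_kerPow_succ T).1 hf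
    obtain ⟨h', hf'⟩ := (mem_kerPow_one T).1 (ih hf)
    refine (mem_kerPow_one T).2 ⟨h, sub_eq_zero.1 ?_⟩
    set y := T ⟨f, h⟩ - (z : ℂ) • f with hy
    rw [← inner_self_eq_zero (𝕜 := ℂ)]
    conv_lhs => rw [hy]
    rw [inner_sub_left, ← hT ⟨y, h'⟩ ⟨f, h⟩, hf', inner_smul_left, inner_smul_right,
      Complex.conj_ofReal, sub_self]

lemma algMult_eq_geomMult_of_symmetric
    (hT : ∀ f g : T.domain, inner ℂ (g : E) (T f) = inner ℂ (T g) (f : E)) (z : ℝ) :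
    algMult T (z : ℂ) = geomMult T (z : ℂ) := by
  rw [algMult, geomMult, iSup_kerPow_of_symmetric T hT]

lemma mem_opSpectrum_of_isEigenval {z : ℂ} (h : IsEigenval T z) : z ∈ opSpectrum T := by
  obtain ⟨f, h0, hf, he⟩ := h
  rintro ⟨R, -, hR⟩
  have := hR ⟨f, hf⟩
  rw [he, sub_self, map_zero] at this
  exact h0 this.symm

end Operators

/-! ### The Laplacian matrix away from the resonances -/

namespace Network

variable {n m : ℕ} (N : Network n m)

lemma represents_iff (f : N.X) (W : ℂ) (p : (Fin m → ℂ) × (Fin n → ℂ)) {F : ℝ → Fin m → ℂ}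
    (hF : ∀ x j, F x j = N.sol W p j x) : N.Represents f F ↔ f = N.edgeFun W p := by
  constructor
  · intro h
    refine N.ext_ae fun j => ?_
    filter_upwards [N.ae_edge_iff.1 (h j), N.edgeFun_ae W p j] with x h1 h2
    rw [h1, h2, hF]
  · rintro rfl j
    rw [N.ae_edge_iff]
    filter_upwards [N.edgeFun_ae W p j] with x h2
    rw [h2, hF]

lemma Φwm_mulVec_apply (a : Fin m → ℂ) (i : Fin n) :
    (N.Φwm *ᵥ a) i = ∑ j, if N.tgt j = i then ((N.μ j * N.c j : ℝ) : ℂ) * a j else 0 := by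
  simp only [Matrix.mulVec, dotProduct, Φwm, Matrix.of_apply, ite_mul, zero_mul]

lemma Φwp_mulVec_apply (a : Fin m → ℂ) (i : Fin n) :
    (N.Φwp *ᵥ a) i = ∑ j, if N.src j = i then ((N.μ j * N.c j : ℝ) : ℂ) * a j else 0 := by
  simp only [Matrix.mulVec, dotProduct, Φwp, Matrix.of_apply, ite_mul, zero_mul]

lemma mem_Γ {i : Fin n} {j : Fin m} : j ∈ N.Γ i ↔ N.src j = i ∨ N.tgt j = i := by
  simp [Γ]

lemma freq_ofReal (w : ℝ) (j : Fin m) : N.freq (w : ℂ) j = ((w / Real.sqrt (N.c j) : ℝ) : ℂ) := by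
  rw [freq, Complex.ofReal_div]

lemma sol_ofReal (w : ℝ) (p : (Fin m → ℂ) × (Fin n → ℂ)) (j : Fin m) (x : ℝ) :
    N.sol (w : ℂ) p j x = ((Real.cos (w * x / Real.sqrt (N.c j)) : ℝ) : ℂ) * p.2 (N.src j) +
      ((Real.sin (w * x / Real.sqrt (N.c j)) : ℝ) : ℂ) * p.1 j := by
  rw [sol, N.freq_ofReal, ← Complex.ofReal_mul, ← Complex.ofReal_cos, ← Complex.ofReal_sin,
    div_mul_eq_mul_div]

lemma solDeriv_ofReal (w : ℝ) (p : (Fin m → ℂ) × (Fin n → ℂ)) (j : Fin m) (x : ℝ) :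
    N.solDeriv (w : ℂ) p j x = ((w / Real.sqrt (N.c j) : ℝ) : ℂ) *
      (((Real.cos (w * x / Real.sqrt (N.c j)) : ℝ) : ℂ) * p.1 j -
      ((Real.sin (w * x / Real.sqrt (N.c j)) : ℝ) : ℂ) * p.2 (N.src j)) := by
  rw [solDeriv, N.freq_ofReal, ← Complex.ofReal_mul, ← Complex.ofReal_cos, ← Complex.ofReal_sin,
    div_mul_eq_mul_div]

/-- Each edge at `i` contributes to the `i`-th component, whichever of its ends lies at `i`. -/
lemma adjC_mulVec (l : ℝ) (d : Fin n → ℂ) (i : Fin n) : (N.adjC l *ᵥ d) i =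
    ∑ j, ((N.μ j * Real.sqrt (N.c j) * (Real.sin (Real.sqrt (l / N.c j)))⁻¹ : ℝ) : ℂ) *
      ((if N.src j = i then d (N.tgt j) else 0) + if N.tgt j = i then d (N.src j) else 0) := by
  set X : Fin m → ℂ := fun j =>
    ((N.μ j * Real.sqrt (N.c j) * (Real.sin (Real.sqrt (l / N.c j)))⁻¹ : ℝ) : ℂ) with hX
  have e : ∀ k, N.adjC l i k * d k = ∑ j, X j *
      ((if N.tgt j = k then if N.src j = i then d k else 0 else 0) +
        if N.src j = k then if N.tgt j = i then d k else 0 else 0) := by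
    intro k
    rw [adjC, Matrix.of_apply]
    split_ifs with hik
    · subst hik
      rw [zero_mul]
      refine (Finset.sum_eq_zero fun j _ => ?_).symm
      have := N.src_ne_tgt j
      grind
    · rw [Finset.sum_mul, ← Finset.sum_filter_add_sum_filter_not Finset.univ
        (fun j => j ∈ N.Γ i ∩ N.Γ k), Finset.filter_univ_mem]
      rw [Finset.sum_eq_zero (s := Finset.univ.filter fun j => ¬ j ∈ N.Γ i ∩ N.Γ k), add_zero]
      · refine Finset.sum_congr rfl fun j hj => ?_
        rw [Finset.mem_inter, N.mem_Γ, N.mem_Γ] at hj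
        have := N.src_ne_tgt j
        congr 1
        grind
      · intro j hj
        rw [Finset.mem_filter, Finset.mem_inter, N.mem_Γ, N.mem_Γ] at hj
        have := N.src_ne_tgt j
        grind
  simp only [Matrix.mulVec, dotProduct, e]
  rw [Finset.sum_comm]
  refine Finset.sum_congr rfl fun j _ => ?_
  rw [← Finset.mul_sum, Finset.sum_add_distrib]
  simp only [Finset.sum_ite_eq, Finset.mem_univ, if_true, hX]

lemma degC_mulVec (l : ℝ) (d : Fin n → ℂ) (i : Fin n) : (N.degC l *ᵥ d) i =
    ∑ j, ((N.μ j * Real.sqrt (N.c j) * Real.cot (Real.sqrt (l / N.c j)) : ℝ) : ℂ) *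
      ((if N.src j = i then d (N.src j) else 0) + if N.tgt j = i then d (N.tgt j) else 0) := by
  rw [degC, Matrix.mulVec_diagonal, Finset.sum_mul, Γ, Finset.sum_filter]
  refine Finset.sum_congr rfl fun j _ => ?_
  have := N.src_ne_tgt j
  split_ifs <;> grind

lemma sin_ne_zero_of_nonResonant {l : ℝ} (h : N.NonResonant l) (j : Fin m) :
    Real.sin (Real.sqrt l / Real.sqrt (N.c j)) ≠ 0 := by
  intro h0
  obtain ⟨k, hk⟩ := Real.sin_eq_zero_iff.1 h0
  refine h.2 j k ?_
  have hc := Real.sqrt_pos.2 (N.c_pos j)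
  rw [eq_div_iff hc.ne'] at hk
  rw [← Real.sq_sqrt h.1.le, ← hk]
  linear_combination (k * Real.pi) ^ 2 * Real.sq_sqrt (N.c_pos j).le

/-- The parameters `(b, d)` of the solution on the edges with the vertex values `d`. -/
noncomputable def nonresParam (l : ℝ) :
    (Fin n → ℂ) →ₗ[ℂ] ((Fin m → ℂ) × (Fin n → ℂ)) where
  toFun d := (fun j => (((Real.sin (Real.sqrt l / Real.sqrt (N.c j)))⁻¹ : ℝ) : ℂ) *
    (d (N.tgt j) - ((Real.cos (Real.sqrt l / Real.sqrt (N.c j)) : ℝ) : ℂ) * d (N.src j)), d)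
  map_add' d e := by
    refine Prod.ext (funext fun j => ?_) rfl
    simp only [Prod.fst_add, Pi.add_apply]; ring
  map_smul' a d := by
    refine Prod.ext (funext fun j => ?_) rfl
    simp only [Prod.smul_fst, Pi.smul_apply, smul_eq_mul, RingHom.id_apply]; ring

lemma nonresParam_fst (l : ℝ) (d : Fin n → ℂ) (j : Fin m) : (N.nonresParam l d).1 j =
    (((Real.sin (Real.sqrt l / Real.sqrt (N.c j)))⁻¹ : ℝ) : ℂ) *
      (d (N.tgt j) - ((Real.cos (Real.sqrt l / Real.sqrt (N.c j)) : ℝ) : ℂ) * d (N.src j)) := rfl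

lemma nonresParam_snd (l : ℝ) (d : Fin n → ℂ) : (N.nonresParam l d).2 = d := rfl

lemma nonresFun_eq {l : ℝ} (h : N.NonResonant l) (d : Fin n → ℂ) (x : ℝ) (j : Fin m) :
    N.nonresFun l d x j = N.sol (Real.sqrt l : ℂ) (N.nonresParam l d) j x := by
  have hinv : (N.Sin (Real.sqrt l))⁻¹ = Matrix.diagonal fun j =>
      (((Real.sin (Real.sqrt l / Real.sqrt (N.c j)))⁻¹ : ℝ) : ℂ) := by
    refine Matrix.inv_eq_right_inv ?_
    rw [Sin, Matrix.diagonal_mul_diagonal, ← Matrix.diagonal_one]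
    congr 1
    funext j
    rw [← Complex.ofReal_mul, mul_inv_cancel₀ (N.sin_ne_zero_of_nonResonant h j),
      Complex.ofReal_one]
  rw [nonresFun, hinv, Sin, Cos, Cos, N.sol_ofReal, nonresParam_fst, nonresParam_snd,
    Pi.add_apply, ← Matrix.mulVec_mulVec, ← Matrix.mulVec_mulVec, ← Matrix.mulVec_mulVec,
    Matrix.sub_mulVec, ← Matrix.mulVec_mulVec, N.Φp_transpose_mulVec, N.Φm_transpose_mulVec]
  simp only [Matrix.mulVec_diagonal, Pi.sub_apply]
  ring

/-- Away from the resonances, the square system amounts to the kernel of the Laplacian matrix: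
the vertex values determine the solution on the edges, and the Kirchhoff law at the vertices is
`√l` times `lapC l *ᵥ d = 0`. -/
lemma vertexMap_eq_zero_iff_lapC {l : ℝ} (h : N.NonResonant l)
    (p : (Fin m → ℂ) × (Fin n → ℂ)) : N.vertexMap (Real.sqrt l : ℂ) p = 0 ↔
      ∃ d, N.lapC l *ᵥ d = 0 ∧ p = N.nonresParam l d := by
  have hs : ∀ j, ((Real.sin (Real.sqrt l / Real.sqrt (N.c j)) : ℝ) : ℂ) ≠ 0 := fun j =>
    Complex.ofReal_ne_zero.2 (N.sin_ne_zero_of_nonResonant h j)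
  have h1 : (∀ j, N.sol (Real.sqrt l : ℂ) p j 1 - p.2 (N.tgt j) = 0) ↔
      p = N.nonresParam l p.2 := by
    rw [Prod.ext_iff, and_iff_left (by rw [nonresParam_snd]), funext_iff]
    refine forall_congr' fun j => ?_
    rw [N.sol_ofReal, mul_one, nonresParam_fst, Complex.ofReal_inv, eq_inv_mul_iff_mul_eq₀ (hs j)]
    grind
  have h2 : ∀ d, (N.Φwm *ᵥ fun j => N.solDeriv (Real.sqrt l : ℂ) (N.nonresParam l d) j 1) -
      (N.Φwp *ᵥ fun j => N.solDeriv (Real.sqrt l : ℂ) (N.nonresParam l d) j 0) =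
      (Real.sqrt l : ℂ) • (N.lapC l *ᵥ d) := by
    intro d
    ext i
    rw [Pi.sub_apply, Pi.smul_apply, lapC, Matrix.sub_mulVec, Pi.sub_apply, N.adjC_mulVec,
      N.degC_mulVec, N.Φwm_mulVec_apply, N.Φwp_mulVec_apply, ← Finset.sum_sub_distrib,
      ← Finset.sum_sub_distrib, Finset.smul_sum]
    refine Finset.sum_congr rfl fun j _ => ?_
    have hsj := hs j
    have hc := N.sqrt_c_ne_zero j
    have hc2 := N.sqrt_c_sq j
    have hp := Complex.sin_sq_add_cos_sq ((Real.sqrt l : ℂ) / (Real.sqrt (N.c j) : ℂ))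
    simp only [N.solDeriv_ofReal, nonresParam_fst, nonresParam_snd, Real.sqrt_div h.1.le,
      Real.cot_eq_cos_div_sin, mul_one, mul_zero, zero_div, Real.cos_zero, Real.sin_zero]
    push_cast at hsj ⊢
    -- `c_j * (√l / √c_j) = √l * √c_j`, so the factor `√l` is common to all edges
    rw [← hc2, smul_eq_mul]
    split_ifs <;> field_simp <;> grind
  rw [N.vertexMap_eq_iff]
  constructor
  · rintro ⟨e1, e2⟩
    have hp := h1.1 e1
    refine ⟨p.2, ?_, hp⟩
    rw [hp, h2] at e2
    exact (smul_eq_zero.1 e2).resolve_left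
      (Complex.ofReal_ne_zero.2 (Real.sqrt_pos.2 h.1).ne')
  · rintro ⟨d, hd, rfl⟩
    exact ⟨h1.2 rfl, by rw [h2, hd, smul_zero]; rfl⟩

lemma nonres_neg_sq {l : ℝ} (h : N.NonResonant l) :
    ((-l : ℝ) : ℂ) = -(Real.sqrt l : ℂ) ^ 2 := by
  rw [← Complex.ofReal_pow, Real.sq_sqrt h.1.le, Complex.ofReal_neg]

lemma sqrt_ne_zero_of_nonResonant {l : ℝ} (h : N.NonResonant l) : (Real.sqrt l : ℂ) ≠ 0 :=
  Complex.ofReal_ne_zero.2 (Real.sqrt_pos.2 h.1).ne'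

lemma isEigenvec_nonres_iff {l : ℝ} (h : N.NonResonant l) (f : N.X) :
    IsEigenvec N.A ((-l : ℝ) : ℂ) f ↔
      ∃ d : Fin n → ℂ, d ≠ 0 ∧ N.lapC l *ᵥ d = 0 ∧ N.Represents f (N.nonresFun l d) := by
  rw [N.nonres_neg_sq h, N.isEigenvec_iff (N.sqrt_ne_zero_of_nonResonant h)]
  have hr : ∀ d, N.Represents f (N.nonresFun l d) ↔
      f = N.edgeFun (Real.sqrt l : ℂ) (N.nonresParam l d) := fun d =>
    N.represents_iff f _ _ (N.nonresFun_eq h d)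
  constructor
  · rintro ⟨p, h0, hp, hf⟩
    obtain ⟨d, hd, rfl⟩ := (N.vertexMap_eq_zero_iff_lapC h p).1 hp
    exact ⟨d, fun e => h0 (by rw [e, map_zero]), hd, (hr d).2 hf⟩
  · rintro ⟨d, h0, hd, hf⟩
    exact ⟨_, fun e => h0 (congrArg Prod.snd e),
      (N.vertexMap_eq_zero_iff_lapC h _).2 ⟨d, hd, rfl⟩, (hr d).1 hf⟩

lemma exists_represents_nonres {l : ℝ} (h : N.NonResonant l) (d : Fin n → ℂ) :
    ∃ f, N.Represents f (N.nonresFun l d) :=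
  ⟨_, (N.represents_iff _ _ _ (N.nonresFun_eq h d)).2 rfl⟩

lemma isEigenval_nonres_iff {l : ℝ} (h : N.NonResonant l) :
    IsEigenval N.A ((-l : ℝ) : ℂ) ↔ (N.lapC l).det = 0 := by
  rw [← Matrix.exists_mulVec_eq_zero_iff]
  constructor
  · rintro ⟨f, hf⟩
    obtain ⟨d, h0, hd, -⟩ := (N.isEigenvec_nonres_iff h f).1 hf
    exact ⟨d, h0, hd⟩
  · rintro ⟨d, h0, hd⟩
    obtain ⟨f, hf⟩ := N.exists_represents_nonres h d
    exact ⟨f, (N.isEigenvec_nonres_iff h f).2 ⟨d, h0, hd, hf⟩⟩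

lemma geomMult_nonres {l : ℝ} (h : N.NonResonant l) :
    geomMult N.A ((-l : ℝ) : ℂ) = Module.rank ℂ (LinearMap.ker (N.lapC l).mulVecLin) := by
  have hW := N.sqrt_ne_zero_of_nonResonant h
  let L : (Fin n → ℂ) →ₗ[ℂ] N.X := N.edgeFun (Real.sqrt l : ℂ) ∘ₗ N.nonresParam l
  have hL : Function.Injective L := by
    refine (injective_iff_map_eq_zero L).2 fun d hd => ?_
    have hs : ∀ j, N.sol (Real.sqrt l : ℂ) (N.nonresParam l d) j 1 = d (N.tgt j) := fun j => by
      have := Complex.ofReal_ne_zero.2 (N.sin_ne_zero_of_nonResonant h j)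
      rw [N.sol_ofReal, mul_one, nonresParam_fst, nonresParam_snd, Complex.ofReal_inv,
        mul_inv_cancel_left₀ this]
      ring
    exact congrArg Prod.snd (N.eq_zero_of_continuous_of_edgeFun hW hs hd)
  have hmap : kerPow N.A ((-l : ℝ) : ℂ) 1 =
      (LinearMap.ker (N.lapC l).mulVecLin).map L := by
    ext f
    rw [mem_kerPow_one, N.nonres_neg_sq h, N.A_eq_smul_iff hW, Submodule.mem_map]
    constructor
    · rintro ⟨p, hp, rfl⟩
      obtain ⟨d, hd, rfl⟩ := (N.vertexMap_eq_zero_iff_lapC h p).1 hp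
      exact ⟨d, hd, rfl⟩
    · rintro ⟨d, hd, rfl⟩
      exact ⟨_, (N.vertexMap_eq_zero_iff_lapC h _).2 ⟨d, hd, rfl⟩, rfl⟩
  rw [geomMult, hmap]
  exact (Submodule.equivMapOfInjective L hL _).symm.rank_eq

/-! ### The resonances -/

lemma resFun_eq (i : Fin m) (k : ℤ) (b : Fin m → ℂ) (d : Fin n → ℂ) (x : ℝ) (j : Fin m) :
    N.resFun i k b d x j =
      N.sol ((Real.sqrt (N.c i) * k * Real.pi : ℝ) : ℂ) (b, d) j x := by
  rw [resFun, Sin, Cos, N.sol_ofReal, Pi.add_apply, ← Matrix.mulVec_mulVec,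
    N.Φp_transpose_mulVec]
  simp only [Matrix.mulVec_diagonal]

/-- At a resonance, `sin` of the frequency of the `j`-th edge vanishes exactly if
`√(c_i/c_j) k` is an integer. Then continuity at the end point restricts `d` only, and otherwise it
determines `b j`. The remaining matrix equation is the Kirchhoff law, divided by `√c_i k π`. -/
lemma resConditions_iff (i : Fin m) {k : ℤ} (hk : k ≠ 0) (b : Fin m → ℂ) (d : Fin n → ℂ) :
    N.ResConditions i k b d ↔
      N.vertexMap ((Real.sqrt (N.c i) * k * Real.pi : ℝ) : ℂ) (b, d) = 0 := by
  set W : ℝ := Real.sqrt (N.c i) * k * Real.pi with hW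
  have hW0 : (W : ℂ) ≠ 0 := by
    refine Complex.ofReal_ne_zero.2 (mul_ne_zero (mul_ne_zero ?_ (by exact_mod_cast hk))
      Real.pi_ne_zero)
    exact (Real.sqrt_pos.2 (N.c_pos i)).ne'
  have hfreq : ∀ j, Real.sqrt (N.c i / N.c j) * k * Real.pi = W / Real.sqrt (N.c j) := fun j => by
    rw [Real.sqrt_div (N.c_pos i).le, hW]; ring
  rw [ResConditions, N.vertexMap_eq_iff]
  refine and_congr (forall_congr' fun j => ?_) ?_
  · rw [N.sol_ofReal, mul_one, ← hfreq j]
    simp only [Prod.fst_zero, Pi.zero_apply]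
    by_cases hK : ∃ K : ℤ, Real.sqrt (N.c i / N.c j) * k = K
    · obtain ⟨K, hK⟩ := hK
      rw [hK, Real.cos_int_mul_pi, Real.sin_int_mul_pi]
      push_cast
      constructor
      · rintro ⟨h, -⟩
        rw [h K rfl]; ring
      · intro h
        refine ⟨fun K' hK' => ?_, fun h => (h ⟨K, rfl⟩).elim⟩
        have : K = K' := by exact_mod_cast hK'
        subst this
        linear_combination -h
    · have hs : Real.sin (Real.sqrt (N.c i / N.c j) * k * Real.pi) ≠ 0 := by
        intro h0
        obtain ⟨K, h1⟩ := Real.sin_eq_zero_iff.1 h0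
        exact hK ⟨K, (mul_right_cancel₀ Real.pi_ne_zero h1).symm⟩
      have hs' := Complex.ofReal_ne_zero.2 hs
      rw [Real.cot_eq_cos_div_sin, Complex.ofReal_div, Complex.ofReal_inv]
      constructor
      · rintro ⟨-, h⟩
        rw [h hK]
        field_simp
        ring
      · intro h
        refine ⟨fun K h => (hK ⟨K, h⟩).elim, fun _ => ?_⟩
        field_simp
        linear_combination h
  · have e : (N.Φwm *ᵥ fun j => N.solDeriv (W : ℂ) (b, d) j 1) -
        (N.Φwp *ᵥ fun j => N.solDeriv (W : ℂ) (b, d) j 0) =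
        (W : ℂ) • ((N.Φwm * N.C * N.Cos W - N.Φwp * N.C) *ᵥ b -
          (N.Φwm * N.C * N.Sin W * N.Φpᵀ) *ᵥ d) := by
      simp only [Matrix.sub_mulVec, ← Matrix.mulVec_mulVec, N.Φp_transpose_mulVec]
      rw [sub_right_comm, ← Matrix.mulVec_sub, ← Matrix.mulVec_sub, smul_sub,
        ← Matrix.mulVec_smul N.Φwm, ← Matrix.mulVec_smul N.Φwp]
      congr 2
      · funext j
        rw [N.solDeriv_ofReal, mul_one]
        simp only [C, Cos, Sin, Pi.smul_apply, Matrix.mulVec_diagonal, Pi.sub_apply, smul_eq_mul]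
        push_cast
        ring
      · funext j
        rw [N.solDeriv_zero, N.freq_ofReal]
        simp only [C, Pi.smul_apply, Matrix.mulVec_diagonal, smul_eq_mul]
        push_cast
        ring
    rw [e, Prod.snd_zero, smul_eq_zero, or_iff_right hW0, sub_eq_zero, eq_comm]

lemma isEigenvec_res_iff (i : Fin m) {k : ℤ} (hk : k ≠ 0) (f : N.X) :
    IsEigenvec N.A ((-(N.c i * (k : ℝ) ^ 2 * Real.pi ^ 2) : ℝ) : ℂ) f ↔
      ∃ b d, (b ≠ 0 ∨ d ≠ 0) ∧ N.ResConditions i k b d ∧ N.Represents f (N.resFun i k b d) := by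
  have hW0 : ((Real.sqrt (N.c i) * k * Real.pi : ℝ) : ℂ) ≠ 0 := by
    refine Complex.ofReal_ne_zero.2 (mul_ne_zero (mul_ne_zero ?_ (by exact_mod_cast hk))
      Real.pi_ne_zero)
    exact (Real.sqrt_pos.2 (N.c_pos i)).ne'
  have hz : ((-(N.c i * (k : ℝ) ^ 2 * Real.pi ^ 2) : ℝ) : ℂ) =
      -((Real.sqrt (N.c i) * k * Real.pi : ℝ) : ℂ) ^ 2 := by
    rw [← Complex.ofReal_pow, mul_pow, mul_pow, Real.sq_sqrt (N.c_pos i).le, Complex.ofReal_neg]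
  rw [hz, N.isEigenvec_iff hW0]
  simp only [N.resConditions_iff i hk, N.represents_iff f _ _ (N.resFun_eq i k _ _)]
  constructor
  · rintro ⟨⟨b, d⟩, h0, h⟩
    refine ⟨b, d, ?_, h⟩
    by_contra! h'
    exact h0 (Prod.ext h'.1 h'.2)
  · rintro ⟨b, d, h0, h⟩
    refine ⟨(b, d), fun h' => ?_, h⟩
    rcases h0 with h0 | h0
    · exact h0 (congrArg Prod.fst h')
    · exact h0 (congrArg Prod.snd h')

lemma exists_represents_res (i : Fin m) (k : ℤ) (b : Fin m → ℂ) (d : Fin n → ℂ) :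
    ∃ f, N.Represents f (N.resFun i k b d) :=
  ⟨_, (N.represents_iff _ _ _ (N.resFun_eq i k b d)).2 rfl⟩

lemma isEigenval_res_iff (i : Fin m) {k : ℤ} (hk : k ≠ 0) :
    IsEigenval N.A ((-(N.c i * (k : ℝ) ^ 2 * Real.pi ^ 2) : ℝ) : ℂ) ↔
      ∃ b d, (b ≠ 0 ∨ d ≠ 0) ∧ N.ResConditions i k b d := by
  constructor
  · rintro ⟨f, hf⟩
    obtain ⟨b, d, h0, h, -⟩ := (N.isEigenvec_res_iff i hk f).1 hf
    exact ⟨b, d, h0, h⟩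
  · rintro ⟨b, d, h0, h⟩
    obtain ⟨f, hf⟩ := N.exists_represents_res i k b d
    exact ⟨f, (N.isEigenvec_res_iff i hk f).2 ⟨b, d, h0, h, hf⟩⟩

/-! ### The spectrum -/

lemma isEigenvec_one : IsEigenvec N.A 0 N.one := by
  obtain ⟨h, he⟩ := N.A_one
  exact ⟨N.one_ne_zero, h, by rw [he, zero_smul]⟩

lemma geomMult_zero : geomMult N.A 0 = 1 := by
  have : kerPow N.A 0 1 = Submodule.span ℂ {N.one} := by
    refine le_antisymm (fun f hf => ?_) ?_
    · obtain ⟨h, he⟩ := (mem_kerPow_one N.A).1 hf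
      rw [zero_smul] at he
      obtain ⟨a, rfl⟩ := N.eq_smul_one_of_A_eq_zero ⟨h, he⟩
      exact Submodule.mem_span_singleton.2 ⟨a, rfl⟩
    · rw [Submodule.span_singleton_le_iff_mem]
      exact ((isEigenvec_iff_mem_kerPow_one N.A).1 N.isEigenvec_one).2
  have hli : LinearIndepOn ℂ id {N.one} := LinearIndepOn.singleton N.one_ne_zero
  rw [geomMult, this, rank_span_set hli, Cardinal.mk_singleton]

/-- The spectrum consists of eigenvalues only. -/
lemma mem_opSpectrum_iff (z : ℂ) : z ∈ opSpectrum N.A ↔ IsEigenval N.A z := by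
  refine ⟨fun hz => ?_, mem_opSpectrum_of_isEigenval N.A⟩
  by_contra hev
  have h0 : z ≠ 0 := by
    rintro rfl
    exact hev ⟨_, N.isEigenvec_one⟩
  have hev' : ¬ IsEigenval N.A ((starRingEnd ℂ) z) := fun h => by
    obtain ⟨l, -, hl⟩ := N.exists_eq_neg_of_isEigenval h
    have : z = (starRingEnd ℂ) z := by
      rw [← Complex.conj_conj z, hl, Complex.conj_ofReal, Complex.conj_ofReal]
    exact hev (this ▸ h)
  have hrange : ∀ z : ℂ, z ≠ 0 → ¬ IsEigenval N.A z → ∀ g : N.X,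
      ∃ f : N.A.domain, z • (f : N.X) - N.A f = g := by
    intro z h0 hev g
    obtain ⟨W, hW⟩ := IsAlgClosed.exists_pow_nat_eq (-z) (n := 2) two_pos
    have hz : z = -W ^ 2 := by rw [hW, neg_neg]
    have hW0 : W ≠ 0 := by
      rintro rfl
      exact h0 (by simpa using hz)
    rw [hz] at hev ⊢
    exact N.exists_sub_A_eq hW0 hev g
  exact notMem_opSpectrum_of_symmetric N.A N.A_inner_symm hev (hrange z h0 hev)
    (hrange _ (by simpa using h0) hev') hz

lemma opSpectrum_A : opSpectrum N.A = {0} ∪ N.σC ∪ N.σL := by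
  ext z
  rw [N.mem_opSpectrum_iff]
  constructor
  · intro h
    obtain ⟨l, hl, rfl⟩ := N.exists_eq_neg_of_isEigenval h
    rcases hl.eq_or_lt with rfl | hl
    · exact Or.inl (Or.inl (by simp))
    by_cases hr : N.NonResonant l
    · exact Or.inr ⟨l, rfl, hr, (N.isEigenval_nonres_iff hr).1 h⟩
    · simp only [NonResonant, hl, true_and, not_forall, not_not] at hr
      obtain ⟨i, k, rfl⟩ := hr
      have hk : k ≠ 0 := by
        rintro rfl
        simp at hl
      exact Or.inl (Or.inr ⟨i, k, hk, rfl, (N.isEigenval_res_iff i hk).1 h⟩)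
  · rintro ((rfl | ⟨i, k, hk, rfl, h⟩) | ⟨l, rfl, hr, h⟩)
    · exact ⟨_, N.isEigenvec_one⟩
    · exact (N.isEigenval_res_iff i hk).2 h
    · exact (N.isEigenval_nonres_iff hr).2 h

end Network

theorem mainTheorem7 {n m : ℕ} (N : Network n m) :
    -- the spectrum
    opSpectrum N.A = {0} ∪ N.σC ∪ N.σL ∧
    -- the eigenvalue `0`
    (IsEigenval N.A 0 ∧ geomMult N.A 0 = 1 ∧ algMult N.A 0 = 1 ∧
      ∃ f : N.X, IsEigenvec N.A 0 f ∧ N.Represents f (fun _ _ => 1)) ∧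
    -- the points `-l` with `l > 0`, `l ≠ c_i k² π²`
    (∀ l : ℝ, N.NonResonant l →
      (IsEigenval N.A ((-l : ℝ) : ℂ) ↔ (N.lapC l).det = 0) ∧
      (∀ d : Fin n → ℂ, d ≠ 0 → N.lapC l *ᵥ d = 0 →
        ∃ f : N.X, IsEigenvec N.A ((-l : ℝ) : ℂ) f ∧ N.Represents f (N.nonresFun l d)) ∧
      (∀ f : N.X, IsEigenvec N.A ((-l : ℝ) : ℂ) f →
        ∃ d : Fin n → ℂ, d ≠ 0 ∧ N.lapC l *ᵥ d = 0 ∧ N.Represents f (N.nonresFun l d)) ∧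
      geomMult N.A ((-l : ℝ) : ℂ) = Module.rank ℂ (LinearMap.ker (N.lapC l).mulVecLin) ∧
      algMult N.A ((-l : ℝ) : ℂ) = Module.rank ℂ (LinearMap.ker (N.lapC l).mulVecLin)) ∧
    -- the points `-c_i k² π²` with `k ≠ 0`
    (∀ (i : Fin m) (k : ℤ), k ≠ 0 →
      (IsEigenval N.A ((-(N.c i * (k : ℝ) ^ 2 * Real.pi ^ 2) : ℝ) : ℂ) ↔
        ∃ b d, (b ≠ 0 ∨ d ≠ 0) ∧ N.ResConditions i k b d) ∧
      (∀ b d, (b ≠ 0 ∨ d ≠ 0) → N.ResConditions i k b d →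
        ∃ f : N.X, IsEigenvec N.A ((-(N.c i * (k : ℝ) ^ 2 * Real.pi ^ 2) : ℝ) : ℂ) f ∧
          N.Represents f (N.resFun i k b d)) ∧
      (∀ f : N.X, IsEigenvec N.A ((-(N.c i * (k : ℝ) ^ 2 * Real.pi ^ 2) : ℝ) : ℂ) f →
        ∃ b d, (b ≠ 0 ∨ d ≠ 0) ∧ N.ResConditions i k b d ∧
          N.Represents f (N.resFun i k b d))) := by
  have h0 : algMult N.A 0 = geomMult N.A 0 := by
    simpa using algMult_eq_geomMult_of_symmetric N.A N.A_inner_symm 0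
  refine ⟨N.opSpectrum_A, ⟨⟨_, N.isEigenvec_one⟩, N.geomMult_zero, h0.trans N.geomMult_zero,
    N.one, N.isEigenvec_one, fun j => N.ae_edge_iff.2 (N.ofFun_ae _ j)⟩, fun l hl => ?_,
    fun i k hk => ?_⟩
  · refine ⟨N.isEigenval_nonres_iff hl, fun d hd hL => ?_,
      fun f hf => (N.isEigenvec_nonres_iff hl f).1 hf, N.geomMult_nonres hl,
      (algMult_eq_geomMult_of_symmetric N.A N.A_inner_symm (-l)).trans (N.geomMult_nonres hl)⟩
    obtain ⟨f, hf⟩ := N.exists_represents_nonres hl d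
    exact ⟨f, (N.isEigenvec_nonres_iff hl f).2 ⟨d, hd, hL, hf⟩, hf⟩
  · refine ⟨N.isEigenval_res_iff i hk, fun b d h0 hb => ?_,
      fun f hf => (N.isEigenvec_res_iff i hk f).1 hf⟩
    obtain ⟨f, hf⟩ := N.exists_represents_res i k b d
    exact ⟨f, (N.isEigenvec_res_iff i hk f).2 ⟨b, d, h0, hb, hf⟩, hf⟩
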